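/- Let $a,b,c$ be real-valued continuous functions on $[t_0,+\infty)$ such that $a(t)\ge 0$ and $c(t)\le 0$ for all $t\ge t_0$, and such that the supports of $a$ and of $c$ are unbounded. Consider the Riccati equation $$x'+a(t)x^2+b(t)x+c(t)=0,\qquad t\ge t_0. \tag{R}$$ For continuous functions $u,v$ on $[t_0,+\infty)$ and $t_1,t\ge t_0$ put $$J_u(t_1;t)=\exp\Big\{\int_{t_1}^t u(\tau)\,d\tau\Big\},\quad I^+_{u,v}(t_1;t)=\int_{t_1}^t u(\tau)J_{-v}(t_1;\tau)\,d\tau,\quad I^-_{u,v}(t_1;t)=\int_{t_1}^t J_{-u}(\tau;t)v(\tau)\,d\tau,$$ and $I^+_{u,v}(t_1)=\lim_{t\to+\infty}I^+_{u,v}(t_1;t)\in[-\infty,+\infty]$ whenever the limit exists (it does in every case below). All integrals $\int_{t_0}^{+\infty}$ are limits of $\int_{t_0}^{t}$ as $t\to+\infty$. A solution of a Riccati equation is called $t_0$-regular if it exists on all of $[t_0,+\infty)$. A $t_0$-regular solution $x$ is called $t_0$-normal if there is a neighbourhood of $x(t_0)$ such that every solution whose value at $t_0$ lies in this neighbourhood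 is $t_0$-regular; otherwise it is called $t_0$-extremal. Say that a solution $x$ changes sign if it is $t_0$-regular and there are $t_2\ge t_1>t_0$ with $x(t)<0$ on $[t_0,t_1)$, $x(t)=0$ on $[t_1,t_2]$ and $x(t)>0$ for $t>t_2$. Then the following hold. **I.** For each real $x_{(0)}\ge -1/I^+_{a,b}(t_0)$ (where $1/I^+_{a,b}(t_0)=0$ if $I^+_{a,b}(t_0)=+\infty$) the solution $x_0$ of (R) with $x_0(t_0)=x_{(0)}$ is $t_0$-regular, and $$\frac{x_{(0)}J_{-b}(t_0;t)}{1+x_{(0)}I^+_{a,b}(t_0;t)}\le x_0(t)\le x_{(0)}J_{-b}(t_0;t)-I^-_{b,c}(t_0;t),\qquad t\ge t_0.$$ Moreover, if $x_{(0)}=0$, then there is $t_1\ge t_0$ such that $x_0(t)=0$ on $[t_0,t_1]$ and $x_0(t)>0$ for $t>t_1$; if $x_{(0)}>0$, then $x_0(t)>0$ for all $t\ge t_0$. **II.** Equation (R) has a unique $t_0$-extremal solution $x_*$, and $x_*(t)<0$ for all $t\ge t_0$. **III.** If $I^+_{a,b}(t_0)=+\infty$ or $I^+_{c,-b}(t_0)=-\infty$,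 then every solution $x$ of (R) with $x(t_0)\in(x_*(t_0),0)$ changes sign. **IV.** If $I^+_{a,b}(t_0)=+\infty$, then $\int_{t_0}^{+\infty}a(\tau)x_N(\tau)\,d\tau=+\infty$ for each $t_0$-normal solution $x_N$ of (R). **V.** If $I^+_{c,-b}(t_0)=-\infty$, then $\int_{t_0}^{+\infty}a(\tau)x_*(\tau)\,d\tau=-\infty$. **VI.** If $I^+_{a,b}(t_0)<+\infty$ and $I^+_{-c,-b}(t_0)<+\infty$, then (R) has a $t_0$-normal solution $x_N^-$ that is negative on $[t_0,+\infty)$ and such that every solution $x$ of (R) with $x(t_0)\in(x_N^-(t_0),0)$ changes sign. **VII.** If $I^+_{a,b}(t_0)=+\infty$ and $\int_{t_0}^{+\infty}|c(\tau)|\,I^-_{-b,a}(t_0;\tau)\,d\tau<+\infty$, then $\int_{t_0}^{+\infty}a(\tau)x_*(\tau)\,d\tau$ converges to a finite value, the equation $$u'-c(t)u^2-b(t)u-a(t)=0,\qquad t\ge t_0,$$ has a unique $t_0$-extremal solution $u_*$, and $\int_{t_0}^{+\infty}c(\tau)u_*(\tau)\,d\tau=+\infty$. -/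

import Mathlib

open Set Filter Topology

namespace Riccati

noncomputable section

/-- `J_u(t₁; t) = exp (∫_{t₁}^t u)`. -/
def J (u : ℝ → ℝ) (t₁ t : ℝ) : ℝ := Real.exp (∫ τ in t₁..t, u τ)

/-- `I⁺_{u,v}(t₁; t) = ∫_{t₁}^t u(τ) J_{-v}(t₁; τ) dτ`. -/
def Iplus (u v : ℝ → ℝ) (t₁ t : ℝ) : ℝ := ∫ τ in t₁..t, u τ * J (-v) t₁ τ

/-- `I⁻_{u,v}(t₁; t) = ∫_{t₁}^t J_{-u}(τ; t) v(τ) dτ`. -/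
def Iminus (u v : ℝ → ℝ) (t₁ t : ℝ) : ℝ := ∫ τ in t₁..t, J (-u) τ t * v τ

/-- The improper integral `∫_{t₁}^{+∞} f` exists in the extended reals and equals `L`, that is,
`∫_{t₁}^t f → L` as `t → +∞`. -/
def HasImproperIntegral (f : ℝ → ℝ) (t₁ : ℝ) (L : EReal) : Prop :=
  Tendsto (fun t : ℝ => ((∫ τ in t₁..t, f τ : ℝ) : EReal)) atTop (𝓝 L)

/-- The value of the improper integral `∫_{t₁}^{+∞} f` in the extended reals. It is meaningful
when the limit exists, in particular for integrands of constant sign (see below). -/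
def improperIntegral (f : ℝ → ℝ) (t₁ : ℝ) : EReal :=
  limUnder atTop (fun t : ℝ => ((∫ τ in t₁..t, f τ : ℝ) : EReal))

theorem HasImproperIntegral.improperIntegral_eq {f : ℝ → ℝ} {t₁ : ℝ} {L : EReal}
    (h : HasImproperIntegral f t₁ L) : improperIntegral f t₁ = L :=
  Tendsto.limUnder_eq h

/-- For a continuous nonnegative integrand the improper integral always exists. -/
theorem hasImproperIntegral_of_nonneg {f : ℝ → ℝ} {t₁ : ℝ} (hf : ContinuousOn f (Ici t₁))
    (h0 : ∀ t, t₁ ≤ t → 0 ≤ f t) : HasImproperIntegral f t₁ (improperIntegral f t₁) := by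
  have hint : ∀ s t, t₁ ≤ s → t₁ ≤ t → IntervalIntegrable f MeasureTheory.volume s t :=
    fun s t hs ht => (hf.mono fun x hx => (le_min hs ht).trans hx.1).intervalIntegrable
  have hmono : Monotone (fun t : ℝ => ((∫ τ in t₁..(max t₁ t), f τ : ℝ) : EReal)) := by
    intro s t hst
    refine EReal.coe_le_coe_iff.2 ?_
    have hst' : max t₁ s ≤ max t₁ t := max_le_max le_rfl hst
    rw [← intervalIntegral.integral_add_adjacent_intervals
      (hint t₁ (max t₁ s) le_rfl (le_max_left _ _))
      (hint (max t₁ s) (max t₁ t) (le_max_left _ _) (le_max_left _ _))]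
    have := intervalIntegral.integral_nonneg (μ := MeasureTheory.volume) hst'
      (fun u hu => h0 u ((le_max_left _ _).trans hu.1))
    linarith
  have hlim : HasImproperIntegral f t₁
      (⨆ t : ℝ, ((∫ τ in t₁..(max t₁ t), f τ : ℝ) : EReal)) := by
    refine (tendsto_atTop_iSup hmono).congr' ?_
    filter_upwards [eventually_ge_atTop t₁] with t ht
    rw [max_eq_right ht]
  rw [hlim.improperIntegral_eq]
  exact hlim

/-- `I⁺_{u,v}(t₁) = ∫_{t₁}^{+∞} u(τ) J_{-v}(t₁; τ) dτ`, an extended real. -/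
def IplusInf (u v : ℝ → ℝ) (t₁ : ℝ) : EReal :=
  improperIntegral (fun τ => u τ * J (-v) t₁ τ) t₁

/-- The support of `f` in `[t₀, +∞)` is unbounded. -/
def UnboundedSupport (f : ℝ → ℝ) (t₀ : ℝ) : Prop :=
  ∀ T, t₀ ≤ T → ∃ t, T ≤ t ∧ f t ≠ 0

/-- `x` is a `t₁`-regular solution of `x' + a x² + b x + c = 0`: it is a solution on the whole
half-line `[t₁, +∞)` (with the one-sided derivative at `t₁`). Only the values of `x` on
`[t₁, +∞)` matter. -/
def IsRegular (a b c : ℝ → ℝ) (t₁ : ℝ) (x : ℝ → ℝ) : Prop :=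
  ∀ t, t₁ ≤ t → HasDerivWithinAt x (-(a t * x t ^ 2 + b t * x t + c t)) (Ici t₁) t

/-- A `t₁`-regular solution is `t₁`-normal if all solutions that start at time `t₁` in some
neighbourhood of `x(t₁)` are `t₁`-regular. (Solutions of initial value problems are unique, so
this says that from each such value there starts a `t₁`-regular solution.) -/
def IsNormal (a b c : ℝ → ℝ) (t₁ : ℝ) (x : ℝ → ℝ) : Prop :=
  IsRegular a b c t₁ x ∧
    ∃ U ∈ 𝓝 (x t₁), ∀ y ∈ U, ∃ z, IsRegular a b c t₁ z ∧ z t₁ = y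

/-- A `t₁`-regular solution is `t₁`-extremal if it is not `t₁`-normal. -/
def IsExtremal (a b c : ℝ → ℝ) (t₁ : ℝ) (x : ℝ → ℝ) : Prop :=
  IsRegular a b c t₁ x ∧ ¬ IsNormal a b c t₁ x

/-- `x` is the unique `t₁`-extremal solution. -/
def IsUniqueExtremal (a b c : ℝ → ℝ) (t₁ : ℝ) (x : ℝ → ℝ) : Prop :=
  IsExtremal a b c t₁ x ∧ ∀ y, IsExtremal a b c t₁ y → EqOn y x (Ici t₁)

/-- The solution starting at time `t₁` from the value `y` is `t₁`-regular and satisfies `P`. -/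
def SolutionFrom (a b c : ℝ → ℝ) (t₁ y : ℝ) (P : (ℝ → ℝ) → Prop) : Prop :=
  (∃ x, IsRegular a b c t₁ x ∧ x t₁ = y) ∧ ∀ x, IsRegular a b c t₁ x → x t₁ = y → P x

/-- There are `t₂ ≥ t₁ > t₀` such that `x < 0` on `[t₀, t₁)`, `x = 0` on `[t₁, t₂]` and `x > 0`
on `(t₂, +∞)`. -/
def ChangesSign (t₀ : ℝ) (x : ℝ → ℝ) : Prop :=
  ∃ t₁ t₂, t₀ < t₁ ∧ t₁ ≤ t₂ ∧ (∀ t ∈ Ico t₀ t₁, x t < 0) ∧ (∀ t ∈ Icc t₁ t₂, x t = 0) ∧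
    ∀ t ∈ Ioi t₂, 0 < x t

end

end Riccati

/-! The equation is linearised. With φ = exp ∫ a x and η = x J_b φ it becomes φ' = A η, η' = C φ,
where A = a J_{-b} and C = -c J_b are nonnegative; conversely x = J_{-b} η / φ wherever φ > 0. A
regular solution with initial value y thus corresponds to φ₁ + y φ₂ staying positive, x has the sign
of η, and ∫ a x = log φ (`IsRegular.eq_quotient`, `exists_isRegular`).

The closed first quadrant is invariant under the system and the Wronskian is constant. Hence the
admissible y form a half-line [y₀, ∞) with y₀ < 0, and η < 0 forever at y₀
(`exists_extremal_value`). Normal means y > y₀, and extremal means y = y₀.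

The rest is the asymptotics of φ and η. For y > y₀, φ is at least (y - y₀) ∫ A, and η becomes
positive if ∫ A or ∫ C diverges. At y₀, φ tends to 0 if ∫ C diverges, but stays away from 0 if ∫ A
diverges while ∫ C (∫ A) converges (`exists_φ_ge`). If both integrals converge, the values with η <
0 forever reach beyond y₀ (`exists_greatest_negative`). The equation for u is the same construction
with A and C exchanged. -/

namespace Riccati

/-! ### One-sided calculus on a half-line. -/

section Calculus

variable {t₀ : ℝ} {f f' : ℝ → ℝ}

theorem intervalIntegrable_of_continuousOn_Ici (hf : ContinuousOn f (Ici t₀)) {s t : ℝ}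
    (hs : t₀ ≤ s) (ht : t₀ ≤ t) : IntervalIntegrable f MeasureTheory.volume s t :=
  (hf.mono fun _ hx => (le_min hs ht).trans hx.1).intervalIntegrable

theorem hasDerivWithinAt_integral (hf : ContinuousOn f (Ici t₀)) {t : ℝ} (ht : t₀ ≤ t) :
    HasDerivWithinAt (fun t => ∫ τ in t₀..t, f τ) (f t) (Ici t₀) t := by
  -- Freezing `f` to the left of `t₀` makes it continuous on ℝ, so the two-sided fundamental theorem
  -- applies.
  have hg : Continuous fun t => f (max t₀ t) :=
    hf.comp_continuous (by fun_prop) fun t => mem_Ici.2 (le_max_left _ _)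
  have h := ((hg.integral_hasStrictDerivAt t₀ t).hasDerivAt.hasDerivWithinAt (s := Ici t₀))
  simp only [max_eq_right ht] at h
  have key : ∀ s ∈ Ici t₀, (∫ τ in t₀..s, f τ) = ∫ τ in t₀..s, f (max t₀ τ) := by
    intro s hs
    refine intervalIntegral.integral_congr fun τ hτ => ?_
    rw [uIcc_of_le hs] at hτ
    simp only [max_eq_right hτ.1]
  exact h.congr key (key t ht)

theorem continuousOn_of_hasDerivWithinAt
    (h : ∀ t, t₀ ≤ t → HasDerivWithinAt f (f' t) (Ici t₀) t) : ContinuousOn f (Ici t₀) :=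
  fun t ht => (h t ht).continuousWithinAt

theorem monotoneOn_of_hasDerivWithinAt
    (h : ∀ t, t₀ ≤ t → HasDerivWithinAt f (f' t) (Ici t₀) t)
    (h0 : ∀ t, t₀ ≤ t → 0 ≤ f' t) : MonotoneOn f (Ici t₀) := by
  refine monotoneOn_of_hasDerivWithinAt_nonneg (f' := f') (convex_Ici t₀)
    (continuousOn_of_hasDerivWithinAt h) (fun t ht => (h t (interior_subset ht)).mono
      interior_subset) fun t ht => h0 t (interior_subset ht)

theorem antitoneOn_of_hasDerivWithinAt
    (h : ∀ t, t₀ ≤ t → HasDerivWithinAt f (f' t) (Ici t₀) t)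
    (h0 : ∀ t, t₀ ≤ t → f' t ≤ 0) : AntitoneOn f (Ici t₀) := by
  have := monotoneOn_of_hasDerivWithinAt (f := fun t => -f t) (f' := fun t => -f' t)
    (fun t ht => (h t ht).fun_neg) (fun t ht => neg_nonneg.2 (h0 t ht))
  exact fun s hs t ht hst => neg_le_neg_iff.1 (this hs ht hst)

theorem eq_of_hasDerivWithinAt_zero
    (h : ∀ t, t₀ ≤ t → HasDerivWithinAt f 0 (Ici t₀) t) {t : ℝ} (ht : t₀ ≤ t) : f t = f t₀ :=
  le_antisymm
    (antitoneOn_of_hasDerivWithinAt h (fun _ _ => le_rfl) (mem_Ici.2 le_rfl) ht ht)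
    (monotoneOn_of_hasDerivWithinAt h (fun _ _ => le_rfl) (mem_Ici.2 le_rfl) ht ht)

theorem integral_nonneg_of_nonneg_Ici (h0 : ∀ t, t₀ ≤ t → 0 ≤ f t) {s t : ℝ}
    (hs : t₀ ≤ s) (hst : s ≤ t) : 0 ≤ ∫ τ in s..t, f τ :=
  intervalIntegral.integral_nonneg hst fun u hu => h0 u (hs.trans hu.1)

theorem exists_integral_pos (hf : ContinuousOn f (Ici t₀)) (h0 : ∀ t, t₀ ≤ t → 0 ≤ f t)
    (hsupp : UnboundedSupport f t₀) {T : ℝ} (hT : t₀ ≤ T) :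
    ∃ t, T ≤ t ∧ 0 < ∫ τ in T..t, f τ := by
  obtain ⟨s, hs, hfs⟩ := hsupp T hT
  refine ⟨s + 1, by linarith, intervalIntegral.integral_pos (by linarith)
    (hf.mono fun x hx => hT.trans hx.1) (fun x hx => h0 x (hT.trans hx.1.le))
    ⟨s, ⟨hs, by linarith⟩, lt_of_le_of_ne (h0 s (hT.trans hs)) hfs.symm⟩⟩

end Calculus

/-- `(φ, η)` solves the linear system `φ' = A η`, `η' = C φ` on `[t₀, +∞)`. -/
structure IsLinSol (A C : ℝ → ℝ) (t₀ : ℝ) (φ η : ℝ → ℝ) : Prop where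
  left : ∀ t, t₀ ≤ t → HasDerivWithinAt φ (A t * η t) (Ici t₀) t
  right : ∀ t, t₀ ≤ t → HasDerivWithinAt η (C t * φ t) (Ici t₀) t

/-! ### Global existence for the linear system by monotone Picard iteration. -/

section Existence

/-- Picard iterates of the linear system `φ' = A η`, `η' = C φ` with initial values `p`, `q`,
frozen to the left of `t₀`. -/
noncomputable def picard (A C : ℝ → ℝ) (t₀ p q : ℝ) : ℕ → (ℝ → ℝ) × (ℝ → ℝ)
  | 0 => (fun _ => 0, fun _ => 0)
  | n + 1 => (fun t => p + ∫ τ in t₀..max t₀ t, A τ * (picard A C t₀ p q n).2 τ,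
      fun t => q + ∫ τ in t₀..max t₀ t, C τ * (picard A C t₀ p q n).1 τ)

variable {A C : ℝ → ℝ} {t₀ p q : ℝ}

theorem continuous_integral_max {g : ℝ → ℝ}
    (hg : ∀ s t, IntervalIntegrable g MeasureTheory.volume s t) :
    Continuous fun t => p + ∫ τ in t₀..max t₀ t, g τ :=
  continuous_const.add
    ((intervalIntegral.continuous_primitive hg t₀).comp (continuous_const.max continuous_id))

theorem picard_continuous (hA : Continuous A) (hC : Continuous C) (n : ℕ) :
    Continuous (picard A C t₀ p q n).1 ∧ Continuous (picard A C t₀ p q n).2 := by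
  induction n with
  | zero => exact ⟨continuous_const, continuous_const⟩
  | succ n ih =>
    exact ⟨continuous_integral_max fun s t => (hA.mul ih.2).intervalIntegrable s t,
      continuous_integral_max fun s t => (hC.mul ih.1).intervalIntegrable s t⟩

/-- Nonnegative coefficients and data make the iteration order preserving, and it starts at 0.
Convergence then needs only a majorant. -/
theorem picard_succ_mono (hA : Continuous A) (hC : Continuous C) (hA0 : ∀ t, 0 ≤ A t)
    (hC0 : ∀ t, 0 ≤ C t) (hp : 0 ≤ p) (hq : 0 ≤ q) (n : ℕ) (t : ℝ) :
    (picard A C t₀ p q n).1 t ≤ (picard A C t₀ p q (n + 1)).1 t ∧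
      (picard A C t₀ p q n).2 t ≤ (picard A C t₀ p q (n + 1)).2 t := by
  induction n generalizing t with
  | zero => simp [picard, hp, hq]
  | succ n ih =>
    have c1 := picard_continuous (t₀ := t₀) (p := p) (q := q) hA hC n
    have c2 := picard_continuous (t₀ := t₀) (p := p) (q := q) hA hC (n + 1)
    exact ⟨add_le_add_right (intervalIntegral.integral_mono_on (le_max_left _ _)
        ((hA.mul c1.2).intervalIntegrable _ _) ((hA.mul c2.2).intervalIntegrable _ _)
        fun s _ => mul_le_mul_of_nonneg_left (ih s).2 (hA0 s)) p,
      add_le_add_right (intervalIntegral.integral_mono_on (le_max_left _ _)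
        ((hC.mul c1.1).intervalIntegrable _ _) ((hC.mul c2.1).intervalIntegrable _ _)
        fun s _ => mul_le_mul_of_nonneg_left (ih s).1 (hC0 s)) q⟩

/-- The common majorant `(p + q) exp (∫ (A + C))` of the Picard iterates. -/
noncomputable def picardBound (A C : ℝ → ℝ) (t₀ p q t : ℝ) : ℝ :=
  (p + q) * Real.exp (∫ τ in t₀..max t₀ t, (A τ + C τ))

theorem picardBound_continuous (hA : Continuous A) (hC : Continuous C) :
    Continuous (picardBound A C t₀ p q) := by
  have := continuous_integral_max (t₀ := t₀) (p := 0) (g := fun τ => A τ + C τ)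
    fun s t => (hA.add hC).intervalIntegrable s t
  simp only [zero_add] at this
  exact continuous_const.mul (Real.continuous_exp.comp this)

/-- The majorant M satisfies M' = (A + C) M and M(t₀) = p + q. Taking B = A and B = C closes the
induction in `picard_le`. -/
theorem integral_mul_picardBound_le (hA : Continuous A) (hC : Continuous C)
    (hp : 0 ≤ p) (hq : 0 ≤ q) {B : ℝ → ℝ} (hB : Continuous B)
    (hBle : ∀ t, B t ≤ A t + C t) (t : ℝ) :
    ∫ τ in t₀..max t₀ t, B τ * picardBound A C t₀ p q τ ≤
      picardBound A C t₀ p q t - (p + q) := by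
  have hcont := picardBound_continuous (t₀ := t₀) (p := p) (q := q) hA hC
  have h1 : ∀ s, t₀ ≤ s → HasDerivWithinAt (fun s => (p + q) * Real.exp (∫ τ in t₀..s, (A τ + C τ))
      - ∫ τ in t₀..s, B τ * picardBound A C t₀ p q τ)
      ((A s + C s - B s) * picardBound A C t₀ p q s) (Ici t₀) s := by
    intro s hs
    refine (((hasDerivWithinAt_integral (f := fun τ => A τ + C τ)
      (hA.add hC).continuousOn hs).exp.const_mul (p + q)).fun_sub
      (hasDerivWithinAt_integral (f := fun τ => B τ * picardBound A C t₀ p q τ)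
        (hB.mul hcont).continuousOn hs)).congr_deriv ?_
    simp only [picardBound, max_eq_right hs]
    ring
  have h2 := monotoneOn_of_hasDerivWithinAt h1 (fun s _ => mul_nonneg
    (sub_nonneg.2 (hBle s)) (mul_nonneg (add_nonneg hp hq) (Real.exp_pos _).le))
    (mem_Ici.2 le_rfl) (le_max_left t₀ t) (le_max_left t₀ t)
  simp only [intervalIntegral.integral_same, Real.exp_zero] at h2
  rw [picardBound]
  linarith

theorem picard_le (hA : Continuous A) (hC : Continuous C) (hA0 : ∀ t, 0 ≤ A t)
    (hC0 : ∀ t, 0 ≤ C t) (hp : 0 ≤ p) (hq : 0 ≤ q) (n : ℕ) (t : ℝ) :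
    (picard A C t₀ p q n).1 t ≤ picardBound A C t₀ p q t ∧
      (picard A C t₀ p q n).2 t ≤ picardBound A C t₀ p q t := by
  induction n generalizing t with
  | zero =>
    have : 0 ≤ picardBound A C t₀ p q t := mul_nonneg (add_nonneg hp hq) (Real.exp_pos _).le
    exact ⟨this, this⟩
  | succ n ih =>
    have c1 := picard_continuous (t₀ := t₀) (p := p) (q := q) hA hC n
    have cB := picardBound_continuous (t₀ := t₀) (p := p) (q := q) hA hC
    have e1 := integral_mul_picardBound_le (t₀ := t₀) hA hC hp hq hA
      (fun t => le_add_of_nonneg_right (hC0 t)) t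
    have e2 := integral_mul_picardBound_le (t₀ := t₀) hA hC hp hq hC
      (fun t => le_add_of_nonneg_left (hA0 t)) t
    have i1 := intervalIntegral.integral_mono_on (μ := MeasureTheory.volume) (le_max_left t₀ t)
        ((hA.mul c1.2).intervalIntegrable _ _) ((hA.mul cB).intervalIntegrable _ _)
        fun s _ => mul_le_mul_of_nonneg_left (ih s).2 (hA0 s)
    have i2 := intervalIntegral.integral_mono_on (μ := MeasureTheory.volume) (le_max_left t₀ t)
        ((hC.mul c1.1).intervalIntegrable _ _) ((hC.mul cB).intervalIntegrable _ _)
        fun s _ => mul_le_mul_of_nonneg_left (ih s).1 (hC0 s)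
    simp only [Pi.mul_apply] at i1 i2
    constructor
    · simp only [picard]; linarith
    · simp only [picard]; linarith

theorem exists_isLinSol_of_continuous (hA : Continuous A) (hC : Continuous C)
    (hA0 : ∀ t, 0 ≤ A t) (hC0 : ∀ t, 0 ≤ C t) (hp : 0 ≤ p) (hq : 0 ≤ q) :
    ∃ φ η : ℝ → ℝ, IsLinSol A C t₀ φ η ∧ φ t₀ = p ∧ η t₀ = q ∧
      ∀ t, t₀ ≤ t → 0 ≤ φ t ∧ 0 ≤ η t := by
  have cB := picardBound_continuous (t₀ := t₀) (p := p) (q := q) hA hC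
  have hm1 : ∀ t, Monotone fun n => (picard A C t₀ p q n).1 t := fun t =>
    monotone_nat_of_le_succ fun n => (picard_succ_mono hA hC hA0 hC0 hp hq n t).1
  have hm2 : ∀ t, Monotone fun n => (picard A C t₀ p q n).2 t := fun t =>
    monotone_nat_of_le_succ fun n => (picard_succ_mono hA hC hA0 hC0 hp hq n t).2
  have hc : ∀ n, Continuous (picard A C t₀ p q n).1 ∧ Continuous (picard A C t₀ p q n).2 :=
    picard_continuous hA hC
  have hle : ∀ n t, (picard A C t₀ p q n).1 t ≤ picardBound A C t₀ p q t ∧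
      (picard A C t₀ p q n).2 t ≤ picardBound A C t₀ p q t :=
    picard_le hA hC hA0 hC0 hp hq
  have hnn1 : ∀ n t, 0 ≤ (picard A C t₀ p q n).1 t := fun n t => hm1 t (Nat.zero_le n)
  have hnn2 : ∀ n t, 0 ≤ (picard A C t₀ p q n).2 t := fun n t => hm2 t (Nat.zero_le n)
  have hl1 : ∀ t, ∃ l, Tendsto (fun n => (picard A C t₀ p q n).1 t) atTop (𝓝 l) := fun t =>
    ⟨_, tendsto_atTop_ciSup (hm1 t) ⟨_, by rintro _ ⟨n, rfl⟩; exact (hle n t).1⟩⟩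
  have hl2 : ∀ t, ∃ l, Tendsto (fun n => (picard A C t₀ p q n).2 t) atTop (𝓝 l) := fun t =>
    ⟨_, tendsto_atTop_ciSup (hm2 t) ⟨_, by rintro _ ⟨n, rfl⟩; exact (hle n t).2⟩⟩
  choose φ hφ using hl1
  choose η hη using hl2
  -- Passage to the limit in the integral equations by dominated convergence; the limit is so far
  -- known only to be measurable.
  have lim : ∀ {B : ℝ → ℝ} {g : ℕ → ℝ → ℝ} {G : ℝ → ℝ}, Continuous B → (∀ t, 0 ≤ B t) →
      (∀ n, Continuous (g n)) → (∀ n t, 0 ≤ g n t) → (∀ n t, g n t ≤ picardBound A C t₀ p q t) →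
      (∀ t, Tendsto (fun n => g n t) atTop (𝓝 (G t))) →
      (∀ s t, IntervalIntegrable (fun τ => B τ * G τ) MeasureTheory.volume s t) ∧
      ∀ t, Tendsto (fun n => ∫ τ in t₀..t, B τ * g n τ) atTop (𝓝 (∫ τ in t₀..t, B τ * G τ)) := by
    intro B g G hB hB0 hg hg0 hgle hG
    have hmeas : Measurable G := measurable_of_tendsto_metrizable (fun n => (hg n).measurable)
      (tendsto_pi_nhds.2 hG)
    have hbd : ∀ n t, ‖B t * g n t‖ ≤ B t * picardBound A C t₀ p q t := fun n t => by
      rw [Real.norm_of_nonneg (mul_nonneg (hB0 t) (hg0 n t))]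
      exact mul_le_mul_of_nonneg_left (hgle n t) (hB0 t)
    constructor
    · intro s t
      refine ((hB.mul cB).intervalIntegrable s t).mono_fun
        (hB.measurable.mul hmeas).aestronglyMeasurable (MeasureTheory.ae_of_all _ fun x => ?_)
      exact (le_of_tendsto ((hG x).const_mul (B x)).norm
        (Eventually.of_forall fun n => hbd n x)).trans (le_abs_self _)
    · intro t
      refine intervalIntegral.tendsto_integral_filter_of_dominated_convergence
        (fun τ => B τ * picardBound A C t₀ p q τ) (Eventually.of_forall fun n =>
          (hB.mul (hg n)).aestronglyMeasurable) (Eventually.of_forall fun n =>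
          MeasureTheory.ae_of_all _ fun x _ => hbd n x) ((hB.mul cB).intervalIntegrable _ _)
          (MeasureTheory.ae_of_all _ fun x _ => (hG x).const_mul (B x))
  obtain ⟨hi1, hlim1⟩ := lim hA hA0 (fun n => (hc n).2) hnn2 (fun n t => (hle n t).2) hη
  obtain ⟨hi2, hlim2⟩ := lim hC hC0 (fun n => (hc n).1) hnn1 (fun n t => (hle n t).1) hφ
  have e1 : ∀ t, φ t = p + ∫ τ in t₀..max t₀ t, A τ * η τ := fun t =>
    tendsto_nhds_unique ((tendsto_add_atTop_iff_nat 1).2 (hφ t))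
      ((hlim1 (max t₀ t)).const_add p)
  have e2 : ∀ t, η t = q + ∫ τ in t₀..max t₀ t, C τ * φ τ := fun t =>
    tendsto_nhds_unique ((tendsto_add_atTop_iff_nat 1).2 (hη t))
      ((hlim2 (max t₀ t)).const_add q)
  -- Continuity of the limit comes from the integral equation it satisfies.
  have cφ : Continuous φ := by rw [funext e1]; exact continuous_integral_max hi1
  have cη : Continuous η := by rw [funext e2]; exact continuous_integral_max hi2
  refine ⟨φ, η, ⟨fun t ht => ?_, fun t ht => ?_⟩, by rw [e1]; simp, by rw [e2]; simp,
    fun t _ => ⟨ge_of_tendsto' (hφ t) fun n => hnn1 n t, ge_of_tendsto' (hη t) fun n => hnn2 n t⟩⟩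
  · have key : ∀ s ∈ Ici t₀, φ s = p + ∫ τ in t₀..s, A τ * η τ := fun s hs => by
      rw [e1, max_eq_right hs]
    exact ((hasDerivWithinAt_integral (hA.mul cη).continuousOn ht).const_add p).congr
      key (key t ht)
  · have key : ∀ s ∈ Ici t₀, η s = q + ∫ τ in t₀..s, C τ * φ τ := fun s hs => by
      rw [e2, max_eq_right hs]
    exact ((hasDerivWithinAt_integral (hC.mul cφ).continuousOn ht).const_add q).congr
      key (key t ht)

theorem exists_isLinSol (hA : ContinuousOn A (Ici t₀)) (hC : ContinuousOn C (Ici t₀))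
    (hA0 : ∀ t, t₀ ≤ t → 0 ≤ A t) (hC0 : ∀ t, t₀ ≤ t → 0 ≤ C t) (hp : 0 ≤ p) (hq : 0 ≤ q) :
    ∃ φ η : ℝ → ℝ, IsLinSol A C t₀ φ η ∧ φ t₀ = p ∧ η t₀ = q ∧
      ∀ t, t₀ ≤ t → 0 ≤ φ t ∧ 0 ≤ η t := by
  have hmax : Continuous fun t => max t₀ t := continuous_const.max continuous_id
  obtain ⟨φ, η, h, h1⟩ := exists_isLinSol_of_continuous (t₀ := t₀)
    (hA.comp_continuous hmax fun t => mem_Ici.2 (le_max_left _ _))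
    (hC.comp_continuous hmax fun t => mem_Ici.2 (le_max_left _ _))
    (fun t => hA0 _ (le_max_left _ _)) (fun t => hC0 _ (le_max_left _ _)) hp hq
  refine ⟨φ, η, ⟨fun t ht => ?_, fun t ht => ?_⟩, h1⟩
  · simpa only [Function.comp_apply, max_eq_right ht] using h.left t ht
  · simpa only [Function.comp_apply, max_eq_right ht] using h.right t ht

end Existence

/-! ### Wronskian, fundamental solutions and invariance of the first quadrant. -/

namespace IsLinSol

variable {A C : ℝ → ℝ} {t₀ : ℝ} {φ η ψ θ : ℝ → ℝ}

theorem swap (h : IsLinSol A C t₀ φ η) : IsLinSol C A t₀ η φ := ⟨h.right, h.left⟩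

theorem neg (h : IsLinSol A C t₀ φ η) :
    IsLinSol A C t₀ (fun t => -φ t) (fun t => -η t) :=
  ⟨fun t ht => (h.left t ht).fun_neg.congr_deriv (by ring),
    fun t ht => (h.right t ht).fun_neg.congr_deriv (by ring)⟩

theorem add_mul (h : IsLinSol A C t₀ φ η) (k : IsLinSol A C t₀ ψ θ) (y : ℝ) :
    IsLinSol A C t₀ (fun t => φ t + y * ψ t) (fun t => η t + y * θ t) :=
  ⟨fun t ht => ((h.left t ht).fun_add ((k.left t ht).const_mul y)).congr_deriv (by ring),
    fun t ht => ((h.right t ht).fun_add ((k.right t ht).const_mul y)).congr_deriv (by ring)⟩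

theorem mono (h : IsLinSol A C t₀ φ η) {T : ℝ} (hT : t₀ ≤ T) : IsLinSol A C T φ η :=
  ⟨fun t ht => (h.left t (hT.trans ht)).mono (Ici_subset_Ici.2 hT),
    fun t ht => (h.right t (hT.trans ht)).mono (Ici_subset_Ici.2 hT)⟩

theorem continuousOn_left (h : IsLinSol A C t₀ φ η) : ContinuousOn φ (Ici t₀) :=
  continuousOn_of_hasDerivWithinAt h.left

theorem wronskian (h : IsLinSol A C t₀ φ η) (k : IsLinSol A C t₀ ψ θ) {t : ℝ} (ht : t₀ ≤ t) :
    φ t * θ t - ψ t * η t = φ t₀ * θ t₀ - ψ t₀ * η t₀ :=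
  eq_of_hasDerivWithinAt_zero (f := fun t => φ t * θ t - ψ t * η t)
    (fun t ht => (((h.left t ht).fun_mul (k.right t ht)).fun_sub
      ((k.left t ht).fun_mul (h.right t ht))).congr_deriv (by ring)) ht

end IsLinSol

/-- Coefficients of the linear system: continuous, nonnegative, with unbounded supports. -/
structure LinCoeff (A C : ℝ → ℝ) (t₀ : ℝ) : Prop where
  contA : ContinuousOn A (Ici t₀)
  contC : ContinuousOn C (Ici t₀)
  nonnegA : ∀ t, t₀ ≤ t → 0 ≤ A t
  nonnegC : ∀ t, t₀ ≤ t → 0 ≤ C t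
  suppA : UnboundedSupport A t₀
  suppC : UnboundedSupport C t₀

/-- `(φ₁, η₁)` and `(φ₂, η₂)` are the fundamental solutions with initial values `(1, 0)` and
`(0, 1)`. -/
structure Fundamental (A C : ℝ → ℝ) (t₀ : ℝ) (φ₁ η₁ φ₂ η₂ : ℝ → ℝ) : Prop where
  sol₁ : IsLinSol A C t₀ φ₁ η₁
  sol₂ : IsLinSol A C t₀ φ₂ η₂
  φ₁_init : φ₁ t₀ = 1
  η₁_init : η₁ t₀ = 0
  φ₂_init : φ₂ t₀ = 0
  η₂_init : η₂ t₀ = 1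
  φ₁_nonneg : ∀ t, t₀ ≤ t → 0 ≤ φ₁ t
  η₁_nonneg : ∀ t, t₀ ≤ t → 0 ≤ η₁ t
  φ₂_nonneg : ∀ t, t₀ ≤ t → 0 ≤ φ₂ t
  η₂_nonneg : ∀ t, t₀ ≤ t → 0 ≤ η₂ t

namespace LinCoeff

variable {A C : ℝ → ℝ} {t₀ : ℝ} {φ η : ℝ → ℝ}

theorem swap (h : LinCoeff A C t₀) : LinCoeff C A t₀ :=
  ⟨h.contC, h.contA, h.nonnegC, h.nonnegA, h.suppC, h.suppA⟩

theorem mono (h : LinCoeff A C t₀) {T : ℝ} (hT : t₀ ≤ T) : LinCoeff A C T :=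
  ⟨h.contA.mono (Ici_subset_Ici.2 hT), h.contC.mono (Ici_subset_Ici.2 hT),
    fun t ht => h.nonnegA t (hT.trans ht), fun t ht => h.nonnegC t (hT.trans ht),
    fun t ht => h.suppA t (hT.trans ht), fun t ht => h.suppC t (hT.trans ht)⟩

theorem exists_fundamental (h : LinCoeff A C t₀) :
    ∃ φ₁ η₁ φ₂ η₂ : ℝ → ℝ, Fundamental A C t₀ φ₁ η₁ φ₂ η₂ := by
  obtain ⟨φ₁, η₁, s₁, p₁, q₁, n₁⟩ := exists_isLinSol h.contA h.contC h.nonnegA h.nonnegC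
    zero_le_one le_rfl
  obtain ⟨φ₂, η₂, s₂, p₂, q₂, n₂⟩ := exists_isLinSol h.contA h.contC h.nonnegA h.nonnegC
    le_rfl zero_le_one
  exact ⟨φ₁, η₁, φ₂, η₂, s₁, s₂, p₁, q₁, p₂, q₂, fun t ht => (n₁ t ht).1,
    fun t ht => (n₁ t ht).2, fun t ht => (n₂ t ht).1, fun t ht => (n₂ t ht).2⟩

end LinCoeff

namespace Fundamental

variable {A C : ℝ → ℝ} {t₀ : ℝ} {φ₁ η₁ φ₂ η₂ φ η : ℝ → ℝ}

theorem wronskian (F : Fundamental A C t₀ φ₁ η₁ φ₂ η₂) {t : ℝ} (ht : t₀ ≤ t) :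
    φ₁ t * η₂ t - φ₂ t * η₁ t = 1 := by
  rw [F.sol₁.wronskian F.sol₂ ht, F.φ₁_init, F.η₂_init, F.φ₂_init]; ring

/-- Cramer's rule with constant Wronskians. This also gives uniqueness for the linear system, hence
for the Riccati equation. -/
theorem eq_combination (F : Fundamental A C t₀ φ₁ η₁ φ₂ η₂) (h : IsLinSol A C t₀ φ η)
    {t : ℝ} (ht : t₀ ≤ t) :
    φ t = φ t₀ * φ₁ t + η t₀ * φ₂ t ∧ η t = φ t₀ * η₁ t + η t₀ * η₂ t := by
  have w := F.wronskian ht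
  have w1 := h.wronskian F.sol₁ ht
  have w2 := h.wronskian F.sol₂ ht
  rw [F.φ₁_init, F.η₁_init] at w1
  rw [F.φ₂_init, F.η₂_init] at w2
  constructor
  · linear_combination (-φ t) * w + φ₁ t * w2 - φ₂ t * w1
  · linear_combination (-η t) * w + η₁ t * w2 - η₂ t * w1

end Fundamental

namespace LinCoeff

variable {A C : ℝ → ℝ} {t₀ : ℝ} {φ η : ℝ → ℝ}

theorem nonneg (h : LinCoeff A C t₀) (s : IsLinSol A C t₀ φ η) (hφ : 0 ≤ φ t₀) (hη : 0 ≤ η t₀)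
    {t : ℝ} (ht : t₀ ≤ t) : 0 ≤ φ t ∧ 0 ≤ η t := by
  obtain ⟨φ₁, η₁, φ₂, η₂, F⟩ := h.exists_fundamental
  rw [(F.eq_combination s ht).1, (F.eq_combination s ht).2]
  exact ⟨add_nonneg (mul_nonneg hφ (F.φ₁_nonneg t ht)) (mul_nonneg hη (F.φ₂_nonneg t ht)),
    add_nonneg (mul_nonneg hφ (F.η₁_nonneg t ht)) (mul_nonneg hη (F.η₂_nonneg t ht))⟩

theorem left_monotoneOn (h : LinCoeff A C t₀) (s : IsLinSol A C t₀ φ η)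
    (hη : ∀ t, t₀ ≤ t → 0 ≤ η t) : MonotoneOn φ (Ici t₀) :=
  monotoneOn_of_hasDerivWithinAt s.left fun t ht => mul_nonneg (h.nonnegA t ht) (hη t ht)

theorem right_monotoneOn (h : LinCoeff A C t₀) (s : IsLinSol A C t₀ φ η)
    (hφ : ∀ t, t₀ ≤ t → 0 ≤ φ t) : MonotoneOn η (Ici t₀) :=
  h.swap.left_monotoneOn s.swap hφ

theorem left_antitoneOn (h : LinCoeff A C t₀) (s : IsLinSol A C t₀ φ η)
    (hη : ∀ t, t₀ ≤ t → η t ≤ 0) : AntitoneOn φ (Ici t₀) :=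
  antitoneOn_of_hasDerivWithinAt s.left fun t ht =>
    mul_nonpos_of_nonneg_of_nonpos (h.nonnegA t ht) (hη t ht)

/-- If `η ≥ k` then `φ` grows at least like `k ∫ A`. -/
theorem left_growth (h : LinCoeff A C t₀) (s : IsLinSol A C t₀ φ η) {k : ℝ}
    (hη : ∀ t, t₀ ≤ t → k ≤ η t) {t : ℝ} (ht : t₀ ≤ t) :
    φ t₀ + k * ∫ τ in t₀..t, A τ ≤ φ t := by
  have := monotoneOn_of_hasDerivWithinAt (f := fun t => φ t - k * ∫ τ in t₀..t, A τ)
    (fun t ht => (s.left t ht).fun_sub ((hasDerivWithinAt_integral h.contA ht).const_mul k))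
    (fun t ht => by
      have := mul_le_mul_of_nonneg_left (hη t ht) (h.nonnegA t ht)
      linarith) (mem_Ici.2 le_rfl) ht ht
  simp only [intervalIntegral.integral_same] at this
  linarith

theorem right_growth (h : LinCoeff A C t₀) (s : IsLinSol A C t₀ φ η) {k : ℝ}
    (hφ : ∀ t, t₀ ≤ t → k ≤ φ t) {t : ℝ} (ht : t₀ ≤ t) :
    η t₀ + k * ∫ τ in t₀..t, C τ ≤ η t :=
  h.swap.left_growth s.swap hφ ht

theorem left_ge (h : LinCoeff A C t₀) (s : IsLinSol A C t₀ φ η) (hφ : 0 ≤ φ t₀) (hη : 0 ≤ η t₀)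
    {t : ℝ} (ht : t₀ ≤ t) : φ t₀ ≤ φ t :=
  h.left_monotoneOn s (fun _ h' => (h.nonneg s hφ hη h').2) (mem_Ici.2 le_rfl) ht ht

theorem right_ge (h : LinCoeff A C t₀) (s : IsLinSol A C t₀ φ η) (hφ : 0 ≤ φ t₀) (hη : 0 ≤ η t₀)
    {t : ℝ} (ht : t₀ ≤ t) : η t₀ ≤ η t :=
  h.swap.left_ge s.swap hη hφ ht

/-- A solution in the closed first quadrant with `η > 0` gets a positive `φ`. -/
theorem exists_left_pos (h : LinCoeff A C t₀) (s : IsLinSol A C t₀ φ η) (hφ : 0 ≤ φ t₀)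
    (hη : 0 < η t₀) : ∃ t, t₀ ≤ t ∧ 0 < φ t := by
  obtain ⟨t, ht, hpos⟩ := exists_integral_pos h.contA h.nonnegA h.suppA le_rfl
  have := h.left_growth s (fun t ht => h.right_ge s hφ hη.le ht) ht
  exact ⟨t, ht, by nlinarith [mul_pos hη hpos]⟩

theorem exists_right_pos (h : LinCoeff A C t₀) (s : IsLinSol A C t₀ φ η) (hφ : 0 < φ t₀)
    (hη : 0 ≤ η t₀) : ∃ t, t₀ ≤ t ∧ 0 < η t :=
  h.swap.exists_left_pos s.swap hη hφ

/-- `φ + η` is dominated by the exponential of `∫ A + ∫ C`. -/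
theorem add_le_exp (h : LinCoeff A C t₀) (s : IsLinSol A C t₀ φ η) (hφ : 0 ≤ φ t₀)
    (hη : 0 ≤ η t₀) {t : ℝ} (ht : t₀ ≤ t) :
    φ t + η t ≤ (φ t₀ + η t₀) * Real.exp ((∫ τ in t₀..t, A τ) + ∫ τ in t₀..t, C τ) := by
  have := antitoneOn_of_hasDerivWithinAt
    (f := fun t => (φ t + η t) * Real.exp (-((∫ τ in t₀..t, A τ) + ∫ τ in t₀..t, C τ)))
    (f' := fun t => -(A t * φ t + C t * η t) *
      Real.exp (-((∫ τ in t₀..t, A τ) + ∫ τ in t₀..t, C τ)))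
    (fun t ht => (((s.left t ht).fun_add (s.right t ht)).fun_mul
      ((hasDerivWithinAt_integral h.contA ht).fun_add
        (hasDerivWithinAt_integral h.contC ht)).fun_neg.exp).congr_deriv (by ring))
    (fun t ht => by
      have n := h.nonneg s hφ hη ht
      have := add_nonneg (mul_nonneg (h.nonnegA t ht) n.1) (mul_nonneg (h.nonnegC t ht) n.2)
      exact mul_nonpos_of_nonpos_of_nonneg (by linarith) (Real.exp_pos _).le)
    (mem_Ici.2 le_rfl) ht ht
  simp only [intervalIntegral.integral_same, add_zero, neg_zero, Real.exp_zero, mul_one,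
    Real.exp_neg] at this
  rwa [mul_inv_le_iff₀ (Real.exp_pos _)] at this

end LinCoeff

/-- The initial values `y` for which `φ₁ + y φ₂` stays positive. -/
def admissible (φ₁ φ₂ : ℝ → ℝ) (t₀ : ℝ) : Set ℝ := {y | ∀ t, t₀ ≤ t → 0 < φ₁ t + y * φ₂ t}

/-! ### The half-line of admissible initial values. -/

namespace Fundamental

variable {A C : ℝ → ℝ} {t₀ : ℝ} {φ₁ η₁ φ₂ η₂ : ℝ → ℝ}

theorem sol (F : Fundamental A C t₀ φ₁ η₁ φ₂ η₂) (y : ℝ) :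
    IsLinSol A C t₀ (fun t => φ₁ t + y * φ₂ t) (fun t => η₁ t + y * η₂ t) :=
  F.sol₁.add_mul F.sol₂ y

theorem wronskian_combination (F : Fundamental A C t₀ φ₁ η₁ φ₂ η₂) (y : ℝ) {t : ℝ}
    (ht : t₀ ≤ t) : (φ₁ t + y * φ₂ t) * η₂ t - φ₂ t * (η₁ t + y * η₂ t) = 1 := by
  linear_combination F.wronskian ht

theorem init (F : Fundamental A C t₀ φ₁ η₁ φ₂ η₂) (y : ℝ) :
    φ₁ t₀ + y * φ₂ t₀ = 1 ∧ η₁ t₀ + y * η₂ t₀ = y := by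
  simp [F.φ₁_init, F.φ₂_init, F.η₁_init, F.η₂_init]

theorem φ₁_ge_one (F : Fundamental A C t₀ φ₁ η₁ φ₂ η₂) (h : LinCoeff A C t₀) {t : ℝ}
    (ht : t₀ ≤ t) : 1 ≤ φ₁ t := by
  have := h.left_ge F.sol₁ (by rw [F.φ₁_init]; exact zero_le_one) F.η₁_init.ge ht
  rwa [F.φ₁_init] at this

theorem η₂_ge_one (F : Fundamental A C t₀ φ₁ η₁ φ₂ η₂) (h : LinCoeff A C t₀) {t : ℝ}
    (ht : t₀ ≤ t) : 1 ≤ η₂ t := by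
  have := h.right_ge F.sol₂ F.φ₂_init.ge (by rw [F.η₂_init]; exact zero_le_one) ht
  rwa [F.η₂_init] at this

theorem integral_le_φ₂ (F : Fundamental A C t₀ φ₁ η₁ φ₂ η₂) (h : LinCoeff A C t₀) {t : ℝ}
    (ht : t₀ ≤ t) : ∫ τ in t₀..t, A τ ≤ φ₂ t := by
  have := h.left_growth F.sol₂ (fun t ht => F.η₂_ge_one h ht) ht
  rw [F.φ₂_init] at this
  linarith

theorem φ₂_monotoneOn (F : Fundamental A C t₀ φ₁ η₁ φ₂ η₂) (h : LinCoeff A C t₀) :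
    MonotoneOn φ₂ (Ici t₀) := h.left_monotoneOn F.sol₂ F.η₂_nonneg

theorem exists_φ₂_pos (F : Fundamental A C t₀ φ₁ η₁ φ₂ η₂) (h : LinCoeff A C t₀) :
    ∃ t, t₀ ≤ t ∧ 0 < φ₂ t :=
  h.exists_left_pos F.sol₂ F.φ₂_init.ge (by rw [F.η₂_init]; exact zero_lt_one)

theorem nonneg_mem_admissible (F : Fundamental A C t₀ φ₁ η₁ φ₂ η₂) (h : LinCoeff A C t₀) {y : ℝ}
    (hy : 0 ≤ y) : y ∈ admissible φ₁ φ₂ t₀ := fun t ht =>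
  add_pos_of_pos_of_nonneg (zero_lt_one.trans_le (F.φ₁_ge_one h ht))
    (mul_nonneg hy (F.φ₂_nonneg t ht))

theorem admissible_of_le (F : Fundamental A C t₀ φ₁ η₁ φ₂ η₂) {y z : ℝ}
    (hy : y ∈ admissible φ₁ φ₂ t₀) (hyz : y ≤ z) : z ∈ admissible φ₁ φ₂ t₀ := fun t ht =>
  (hy t ht).trans_le (add_le_add_right (mul_le_mul_of_nonneg_right hyz (F.φ₂_nonneg t ht)) _)

/-- Once `φ > 0` and `η ≥ 0`, eventually `η > 0`. -/
theorem exists_η_pos (F : Fundamental A C t₀ φ₁ η₁ φ₂ η₂) (h : LinCoeff A C t₀) {y T : ℝ}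
    (hy : y ∈ admissible φ₁ φ₂ t₀) (hT : t₀ ≤ T) (hη : 0 ≤ η₁ T + y * η₂ T) :
    ∃ t, T ≤ t ∧ 0 < η₁ t + y * η₂ t :=
  (h.mono hT).exists_right_pos ((F.sol y).mono hT) (hy T hT) hη

theorem φ_pos_bound (F : Fundamental A C t₀ φ₁ η₁ φ₂ η₂) {y T : ℝ}
    (hy : y ∈ admissible φ₁ φ₂ t₀) (hT : t₀ ≤ T) :
    ∃ m, 0 < m ∧ ∀ t ∈ Icc t₀ T, m ≤ φ₁ t + y * φ₂ t := by
  obtain ⟨s, hs, hmin⟩ := isCompact_Icc.exists_isMinOn (nonempty_Icc.2 hT)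
    ((F.sol y).continuousOn_left.mono Icc_subset_Ici_self)
  exact ⟨_, hy s hs.1, fun t ht => hmin ht⟩

/-- Once η > 0 at some T', y can be lowered slightly: φ stays positive on the compact interval up to
T', and beyond it the solution is trapped in the first quadrant. -/
theorem exists_sub_mem_admissible (F : Fundamental A C t₀ φ₁ η₁ φ₂ η₂) (h : LinCoeff A C t₀)
    {y T : ℝ} (hy : y ∈ admissible φ₁ φ₂ t₀) (hT : t₀ ≤ T) (hη : 0 ≤ η₁ T + y * η₂ T) :
    ∃ ε, 0 < ε ∧ y - ε ∈ admissible φ₁ φ₂ t₀ := by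
  obtain ⟨T', hTT', hpos⟩ := F.exists_η_pos h hy hT hη
  have hT' := hT.trans hTT'
  obtain ⟨m, hm, hmin⟩ := F.φ_pos_bound hy hT'
  have hφ := F.φ₂_nonneg T' hT'
  have hη2 := F.η₂_nonneg T' hT'
  set k := min m (η₁ T' + y * η₂ T')
  have hk : 0 < k := lt_min hm hpos
  -- The summand 1 makes the bounds ε φ₂(T') < k and ε η₂(T') < k strict for ε = k / D.
  set D := φ₂ T' + η₂ T' + 1
  have hD : 0 < D := by positivity
  have hε : k / D * D = k := div_mul_cancel₀ _ hD.ne'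
  have hε0 : 0 < k / D := by positivity
  have e1 : k / D * φ₂ T' < m :=
    lt_of_lt_of_le (lt_of_lt_of_eq (mul_lt_mul_of_pos_left (by simp only [D]; linarith) hε0) hε)
      (min_le_left _ _)
  have e2 : k / D * η₂ T' < η₁ T' + y * η₂ T' :=
    lt_of_lt_of_le (lt_of_lt_of_eq (mul_lt_mul_of_pos_left (by simp only [D]; linarith) hε0) hε)
      (min_le_right _ _)
  have hbefore : ∀ t ∈ Icc t₀ T', 0 < φ₁ t + (y - k / D) * φ₂ t := fun t ht => by
    have := mul_le_mul_of_nonneg_left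
      (F.φ₂_monotoneOn h (mem_Ici.2 ht.1) (mem_Ici.2 hT') ht.2) hε0.le
    linarith [hmin t ht, sub_mul y (k / D) (φ₂ t)]
  refine ⟨k / D, hε0, fun t ht => ?_⟩
  rcases le_total t T' with htT | htT
  · exact hbefore t ⟨ht, htT⟩
  · have p := hbefore T' ⟨hT', le_rfl⟩
    exact p.trans_le ((h.mono hT').left_ge ((F.sol (y - k / D)).mono hT') p.le
      (by linarith [sub_mul y (k / D) (η₂ T')]) htT)

/-- The admissible initial values form a half-line `[y₀, +∞)` with `y₀ < 0`, and the solution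
from `y₀` has negative `η`. -/
theorem exists_extremal_value (F : Fundamental A C t₀ φ₁ η₁ φ₂ η₂) (h : LinCoeff A C t₀) :
    ∃ y₀ < 0, (∀ y, y ∈ admissible φ₁ φ₂ t₀ ↔ y₀ ≤ y) ∧
      ∀ t, t₀ ≤ t → η₁ t + y₀ * η₂ t < 0 := by
  obtain ⟨T, hT, hφT⟩ := F.exists_φ₂_pos h
  have hbdd : BddBelow (admissible φ₁ φ₂ t₀) := ⟨-(φ₁ T / φ₂ T), fun y hy => by
    have : 0 < (φ₁ T + y * φ₂ T) / φ₂ T := div_pos (hy T hT) hφT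
    rw [add_div, mul_div_cancel_right₀ _ hφT.ne'] at this
    linarith⟩
  have h0 := F.nonneg_mem_admissible h le_rfl
  set y₀ := sInf (admissible φ₁ φ₂ t₀) with hy₀
  have hgt : ∀ y, y₀ < y → y ∈ admissible φ₁ φ₂ t₀ := fun y hy => by
    obtain ⟨z, hz, hzy⟩ := exists_lt_of_csInf_lt ⟨0, h0⟩ hy
    exact F.admissible_of_le hz hzy.le
  have hnn : ∀ t, t₀ ≤ t → 0 ≤ φ₁ t + y₀ * φ₂ t := fun t ht => by
    have hcont : Continuous fun y => φ₁ t + y * φ₂ t := by fun_prop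
    exact ge_of_tendsto ((hcont.tendsto y₀).mono_left nhdsWithin_le_nhds)
      (eventually_mem_nhdsWithin.mono fun y hy => (hgt y hy t ht).le : ∀ᶠ y in 𝓝[>] y₀, _)
  -- The infimum is attained: if φ vanished at t, the Wronskian would force η(t) < 0. The negated
  -- solution, then in the first quadrant, would make φ negative later.
  have hmem : y₀ ∈ admissible φ₁ φ₂ t₀ := fun t ht => by
    refine (hnn t ht).lt_of_ne fun heq => ?_
    have w := F.wronskian_combination y₀ ht
    rw [← heq] at w
    have hη : 0 < -(η₁ t + y₀ * η₂ t) := by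
      by_contra hcon
      nlinarith [F.φ₂_nonneg t ht]
    obtain ⟨s, hs, hpos⟩ := (h.mono ht).exists_left_pos ((F.sol y₀).mono ht).neg
      (by linarith) hη
    linarith [hnn s (ht.trans hs)]
  have hlt : ∀ ε, 0 < ε → y₀ - ε ∉ admissible φ₁ φ₂ t₀ := fun ε hε hcon => by
    linarith [csInf_le hbdd hcon]
  refine ⟨y₀, ?_, fun y => ⟨fun hy => csInf_le hbdd hy, fun hy => F.admissible_of_le hmem hy⟩,
    fun t ht => ?_⟩
  · obtain ⟨ε, hε, hmemε⟩ := F.exists_sub_mem_admissible h h0 le_rfl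
      (by rw [F.η₁_init, zero_mul, add_zero])
    linarith [csInf_le hbdd hmemε]
  · by_contra hcon
    obtain ⟨ε, hε, hmemε⟩ := F.exists_sub_mem_admissible h hmem ht (not_lt.1 hcon)
    exact hlt ε hε hmemε

/-! ### Asymptotics of φ and η at and above the extremal value. -/

section Extremal

variable {y₀ y : ℝ}

theorem φ_ge_mul_integral (F : Fundamental A C t₀ φ₁ η₁ φ₂ η₂) (h : LinCoeff A C t₀)
    (hy₀ : y₀ ∈ admissible φ₁ φ₂ t₀) (hy : y₀ < y) {t : ℝ} (ht : t₀ ≤ t) :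
    (y - y₀) * φ₂ t ≤ φ₁ t + y * φ₂ t ∧
      (y - y₀) * ∫ τ in t₀..t, A τ ≤ φ₁ t + y * φ₂ t := by
  have h1 : (y - y₀) * φ₂ t ≤ φ₁ t + y * φ₂ t := by linarith [hy₀ t ht, sub_mul y y₀ (φ₂ t)]
  exact ⟨h1, (mul_le_mul_of_nonneg_left (F.integral_le_φ₂ h ht) (sub_pos.2 hy).le).trans h1⟩

theorem tendsto_φ_atTop (F : Fundamental A C t₀ φ₁ η₁ φ₂ η₂) (h : LinCoeff A C t₀)
    (hy₀ : y₀ ∈ admissible φ₁ φ₂ t₀) (hy : y₀ < y)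
    (hα : Tendsto (fun t => ∫ τ in t₀..t, A τ) atTop atTop) :
    Tendsto (fun t => φ₁ t + y * φ₂ t) atTop atTop := by
  refine tendsto_atTop_mono' _ ?_ (hα.const_mul_atTop (sub_pos.2 hy))
  filter_upwards [eventually_ge_atTop t₀] with t ht using (F.φ_ge_mul_integral h hy₀ hy ht).2

/-- If η ≤ 0 forever, φ is nonincreasing. This contradicts φ → ∞ when ∫ A diverges; when ∫ C
diverges, φ is still bounded below by a multiple of φ₂, which drives η upwards without bound. -/
theorem exists_η_pos_of_divergent (F : Fundamental A C t₀ φ₁ η₁ φ₂ η₂) (h : LinCoeff A C t₀)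
    (hy₀ : y₀ ∈ admissible φ₁ φ₂ t₀) (hy : y₀ < y)
    (hdiv : Tendsto (fun t => ∫ τ in t₀..t, A τ) atTop atTop ∨
      Tendsto (fun t => ∫ τ in t₀..t, C τ) atTop atTop) :
    ∃ t, t₀ ≤ t ∧ 0 < η₁ t + y * η₂ t := by
  by_contra! hcon
  have hanti := h.left_antitoneOn (F.sol y) hcon
  rcases hdiv with hα | hγ
  · obtain ⟨t, h1, ht⟩ := (((F.tendsto_φ_atTop h hy₀ hy hα).eventually_gt_atTop 1).and
      (eventually_ge_atTop t₀)).exists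
    have := hanti (mem_Ici.2 le_rfl) ht ht
    simp only at this
    rw [(F.init y).1] at this
    linarith
  · obtain ⟨T, hT, hpos⟩ := F.exists_φ₂_pos h
    have hk : 0 < (y - y₀) * φ₂ T := mul_pos (sub_pos.2 hy) hpos
    -- Compare at the later time max(t, T): φ only decreases up to it, while φ₂ has at least its
    -- value at T there.
    have hge : ∀ t, t₀ ≤ t → (y - y₀) * φ₂ T ≤ φ₁ t + y * φ₂ t := fun t ht => by
      refine le_trans ?_ (hanti ht (mem_Ici.2 (ht.trans (le_max_left t T))) (le_max_left t T))
      exact (mul_le_mul_of_nonneg_left (F.φ₂_monotoneOn h hT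
        (mem_Ici.2 (ht.trans (le_max_left t T))) (le_max_right t T)) (sub_pos.2 hy).le).trans
        (F.φ_ge_mul_integral h hy₀ hy (ht.trans (le_max_left t T))).1
    obtain ⟨t, h1, ht⟩ := (((hγ.const_mul_atTop hk).eventually_gt_atTop (-y)).and
      (eventually_ge_atTop t₀)).exists
    have := h.right_growth (F.sol y) hge ht
    rw [(F.init y).2] at this
    linarith [hcon t ht]

/-- If `∫ C` diverges, a solution with `φ > 0` and `η < 0` satisfies `φ → 0`. -/
theorem tendsto_φ_zero (F : Fundamental A C t₀ φ₁ η₁ φ₂ η₂) (h : LinCoeff A C t₀)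
    (hy₀ : y₀ ∈ admissible φ₁ φ₂ t₀) (hneg : ∀ t, t₀ ≤ t → η₁ t + y₀ * η₂ t < 0)
    (hγ : Tendsto (fun t => ∫ τ in t₀..t, C τ) atTop atTop) :
    Tendsto (fun t => φ₁ t + y₀ * φ₂ t) atTop (𝓝 0) := by
  have hanti := h.left_antitoneOn (F.sol y₀) fun t ht => (hneg t ht).le
  have hsmall : ∀ ε, 0 < ε → ∃ T, t₀ ≤ T ∧ φ₁ T + y₀ * φ₂ T < ε := fun ε hε => by
    by_contra! hcon
    obtain ⟨t, h1, ht⟩ := (((hγ.const_mul_atTop hε).eventually_gt_atTop (-y₀)).and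
      (eventually_ge_atTop t₀)).exists
    have := h.right_growth (F.sol y₀) hcon ht
    rw [(F.init y₀).2] at this
    linarith [hneg t ht]
  refine tendsto_order.2 ⟨fun a ha => ?_, fun a ha => ?_⟩
  · filter_upwards [eventually_ge_atTop t₀] with t ht using ha.trans (hy₀ t ht)
  · obtain ⟨T, hT, hlt⟩ := hsmall a ha
    filter_upwards [eventually_ge_atTop T] with t ht
      using (hanti hT (mem_Ici.2 (hT.trans ht)) ht).trans_lt hlt

/-- If `∫ A` and `∫ C` are bounded, there is a largest initial value with `η < 0`, and it is not
the extremal one. -/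
theorem exists_greatest_negative (F : Fundamental A C t₀ φ₁ η₁ φ₂ η₂) (h : LinCoeff A C t₀)
    (hS : ∀ y, y ∈ admissible φ₁ φ₂ t₀ ↔ y₀ ≤ y)
    (hneg : ∀ t, t₀ ≤ t → η₁ t + y₀ * η₂ t < 0) {K : ℝ}
    (hα : ∀ t, t₀ ≤ t → ∫ τ in t₀..t, A τ ≤ K) (hγ : ∀ t, t₀ ≤ t → ∫ τ in t₀..t, C τ ≤ K) :
    ∃ y₁, y₀ < y₁ ∧ (∀ t, t₀ ≤ t → η₁ t + y₁ * η₂ t < 0) ∧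
      ∀ y, y₁ < y → ∃ t, t₀ ≤ t ∧ 0 < η₁ t + y * η₂ t := by
  set N : Set ℝ := {y | ∀ t, t₀ ≤ t → η₁ t + y * η₂ t ≤ 0} with hN
  have hy₀N : y₀ ∈ N := fun t ht => (hneg t ht).le
  have hbdd : BddAbove N := ⟨0, fun y hy => by
    have := hy t₀ le_rfl
    rwa [(F.init y).2] at this⟩
  set y₁ := sSup N
  have hgt : ∀ y, y₁ < y → ∃ t, t₀ ≤ t ∧ 0 < η₁ t + y * η₂ t := fun y hy => by
    by_contra! hcon
    exact absurd (le_csSup hbdd hcon) (not_le.2 hy)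
  have hle : y₀ ≤ y₁ := le_csSup hbdd hy₀N
  have hmem : ∀ t, t₀ ≤ t → η₁ t + y₁ * η₂ t ≤ 0 := fun t ht => by
    have hcont : Continuous fun y => η₁ t + y * η₂ t := by fun_prop
    refine le_of_tendsto ((hcont.tendsto y₁).mono_left nhdsWithin_le_nhds)
      (eventually_mem_nhdsWithin.mono fun y hy => ?_ : ∀ᶠ y in 𝓝[<] y₁, _)
    obtain ⟨z, hz, hyz⟩ := exists_lt_of_lt_csSup ⟨y₀, hy₀N⟩ hy
    exact (add_le_add_right (mul_le_mul_of_nonneg_right hyz.le (F.η₂_nonneg t ht)) _).trans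
      (hz t ht)
  have hy₁ : y₁ ∈ admissible φ₁ φ₂ t₀ := (hS y₁).2 hle
  set M := Real.exp (K + K)
  have hM : 0 < M := Real.exp_pos _
  have hbd : ∀ t, t₀ ≤ t → φ₂ t ≤ M ∧ η₂ t ≤ M := fun t ht => by
    have := h.add_le_exp F.sol₂ F.φ₂_init.ge (by rw [F.η₂_init]; exact zero_le_one) ht
    rw [F.φ₂_init, F.η₂_init, zero_add, one_mul] at this
    have h2 := this.trans (Real.exp_le_exp.2 (add_le_add (hα t ht) (hγ t ht)))
    exact ⟨by linarith [F.η₂_nonneg t ht], by linarith [F.φ₂_nonneg t ht]⟩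
  refine ⟨y₁, ?_, fun t ht => (hmem t ht).lt_of_ne fun heq => ?_, hgt⟩
  -- Let δ = 1 / (2M). Since η becomes positive just above y₁, at y₁ it exceeds -δ at some T, and
  -- keeps doing so. The Wronskian then gives φ η₂ = 1 + φ₂ η ≥ 1/2, so φ ≥ δ. Lowering y₁ by δ /
  -- (2M) keeps φ positive, so y₁ > y₀.
  · have hδ : 0 < 1 / (2 * M) := by positivity
    have hδM : 1 / (2 * M) * M = 1 / 2 := by field_simp
    obtain ⟨T, hT, hTη⟩ : ∃ T, t₀ ≤ T ∧ -(1 / (2 * M)) < η₁ T + y₁ * η₂ T := by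
      obtain ⟨T, hT, hpos⟩ := hgt (y₁ + 1 / (2 * M) / M) (by linarith [div_pos hδ hM])
      refine ⟨T, hT, ?_⟩
      have h1 := mul_le_mul_of_nonneg_left (hbd T hT).2 (div_pos hδ hM).le
      rw [div_mul_cancel₀ _ hM.ne'] at h1
      linarith [add_mul y₁ (1 / (2 * M) / M) (η₂ T)]
    have hmono := h.right_monotoneOn (F.sol y₁) fun t ht => (hy₁ t ht).le
    have hanti := h.left_antitoneOn (F.sol y₁) hmem
    have hlate : ∀ t, T ≤ t → 1 / (2 * M) ≤ φ₁ t + y₁ * φ₂ t := fun t ht => by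
      have ht' := hT.trans ht
      have w := F.wronskian_combination y₁ ht'
      have hη := hTη.trans_le (hmono hT ht' ht)
      have e1 : φ₂ t * -(η₁ t + y₁ * η₂ t) ≤ M * (1 / (2 * M)) :=
        mul_le_mul (hbd t ht').1 (by linarith) (by linarith [hmem t ht']) hM.le
      have e2 := mul_le_mul_of_nonneg_left (hbd t ht').2 (hy₁ t ht').le
      rw [div_le_iff₀ (by positivity)]
      linarith
    have hall : ∀ t, t₀ ≤ t → 1 / (2 * M) ≤ φ₁ t + y₁ * φ₂ t := fun t ht =>
      (hlate _ (le_max_right t T)).trans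
        (hanti ht (mem_Ici.2 (ht.trans (le_max_left _ _))) (le_max_left _ _))
    have hε : 0 < 1 / (2 * M) / (2 * M) := by positivity
    have : y₁ - 1 / (2 * M) / (2 * M) ∈ admissible φ₁ φ₂ t₀ := fun t ht => by
      have h1 := mul_le_mul_of_nonneg_left (hbd t ht).1 hε.le
      have h2 : 1 / (2 * M) / (2 * M) * M = 1 / (2 * M) / 2 := by field_simp
      linarith [hall t ht, sub_mul y₁ (1 / (2 * M) / (2 * M)) (φ₂ t)]
    linarith [(hS _).1 this]
  -- A zero of η would be followed by positive values.
  · obtain ⟨s, hs, hpos⟩ := F.exists_η_pos h hy₁ ht heq.ge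
    linarith [hmem s (ht.trans hs)]

/-- If `∫ A` diverges and `∫ C (∫ A)` is bounded, a solution with `φ > 0` and `η < 0` has `φ`
bounded away from zero. -/
theorem exists_φ_ge (F : Fundamental A C t₀ φ₁ η₁ φ₂ η₂) (h : LinCoeff A C t₀)
    (hy₀ : y₀ ∈ admissible φ₁ φ₂ t₀) (hneg : ∀ t, t₀ ≤ t → η₁ t + y₀ * η₂ t < 0)
    (hα : Tendsto (fun t => ∫ τ in t₀..t, A τ) atTop atTop) {k : ℝ}
    (hk : Tendsto (fun t => ∫ τ in t₀..t, C τ * ∫ σ in t₀..τ, A σ) atTop (𝓝 k)) :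
    ∃ m, 0 < m ∧ ∀ t, t₀ ≤ t → m ≤ φ₁ t + y₀ * φ₂ t := by
  set φ : ℝ → ℝ := fun t => φ₁ t + y₀ * φ₂ t with hφdef
  set η : ℝ → ℝ := fun t => η₁ t + y₀ * η₂ t with hηdef
  set α : ℝ → ℝ := fun t => ∫ τ in t₀..t, A τ with hαdef
  set κ : ℝ → ℝ := fun t => ∫ τ in t₀..t, C τ * α τ with hκdef
  have hsol : IsLinSol A C t₀ φ η := F.sol y₀
  have dα : ∀ t, t₀ ≤ t → HasDerivWithinAt α (A t) (Ici t₀) t := fun t ht =>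
    hasDerivWithinAt_integral h.contA ht
  have cα : ContinuousOn α (Ici t₀) := continuousOn_of_hasDerivWithinAt dα
  have α0 : ∀ t, t₀ ≤ t → 0 ≤ α t := fun t ht =>
    integral_nonneg_of_nonneg_Ici h.nonnegA le_rfl ht
  have dκ : ∀ t, t₀ ≤ t → HasDerivWithinAt κ (C t * α t) (Ici t₀) t := fun t ht =>
    hasDerivWithinAt_integral (h.contC.mul cα) ht
  have κmono : MonotoneOn κ (Ici t₀) := monotoneOn_of_hasDerivWithinAt dκ
    fun t ht => mul_nonneg (h.nonnegC t ht) (α0 t ht)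
  have κle : ∀ t, t₀ ≤ t → κ t ≤ k := fun t ht => ge_of_tendsto hk
    ((eventually_ge_atTop t).mono fun s hs => κmono ht (mem_Ici.2 (ht.trans hs)) hs)
  have φpos : ∀ t, t₀ ≤ t → 0 < φ t := hy₀
  have φanti : AntitoneOn φ (Ici t₀) := h.left_antitoneOn hsol fun t ht => (hneg t ht).le
  -- φ - η α has derivative -C φ α ≤ 0 and starts at 1. As α → ∞, this forces η → 0.
  have hαη : ∀ t, t₀ ≤ t → -η t * α t ≤ 1 := fun t ht => by
    have := antitoneOn_of_hasDerivWithinAt (f := fun t => φ t - η t * α t)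
      (f' := fun t => -(C t * φ t * α t))
      (fun t ht => ((hsol.left t ht).fun_sub ((hsol.right t ht).fun_mul (dα t ht))).congr_deriv
        (by ring))
      (fun t ht => neg_nonpos.2 (mul_nonneg (mul_nonneg (h.nonnegC t ht) (φpos t ht).le)
        (α0 t ht))) (mem_Ici.2 le_rfl) ht ht
    have i1 : φ t₀ = 1 := (F.init y₀).1
    have i2 : α t₀ = 0 := intervalIntegral.integral_same
    simp only [i1, i2, mul_zero, sub_zero] at this
    linarith [φpos t ht]
  have ηsmall : ∀ ε, 0 < ε → ∀ᶠ t in atTop, -η t < ε := fun ε hε => by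
    filter_upwards [hα.eventually_gt_atTop (1 / ε), eventually_ge_atTop t₀] with t h1 ht
    by_contra! hcon
    have : 1 < ε * α t := by rwa [div_lt_iff₀' hε] at h1
    nlinarith [hαη t ht, mul_le_mul_of_nonneg_right hcon (α0 t ht)]
  -- From t on, the tail of ∫ C α is less than 1/2.
  obtain ⟨t, hkt, ht⟩ := ((hk.eventually (lt_mem_nhds (show k - 1 / 2 < k by linarith))).and
    (eventually_ge_atTop t₀)).exists
  change k - 1 / 2 < κ t at hkt
  -- Since η → 0, -η(s) is the integral of C φ over [s, ∞). With α increasing and φ decreasing, α(s)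
  -- times it is at most φ(s) times the tail of ∫ C α.
  have hαη2 : ∀ s, t ≤ s → -η s * α s ≤ φ s / 2 := fun s hs => by
    have hs' := ht.trans hs
    have key : ∀ r, s ≤ r → α s * -η s ≤ φ s / 2 + α s * -η r := fun r hr => by
      have := monotoneOn_of_hasDerivWithinAt (t₀ := s) (f := fun r => φ s * κ r - α s * η r)
        (f' := fun r => C r * (φ s * α r - α s * φ r))
        (fun r hr => ((((dκ r (hs'.trans hr)).const_mul (φ s)).fun_sub
          ((hsol.right r (hs'.trans hr)).const_mul (α s))).mono
            (Ici_subset_Ici.2 hs')).congr_deriv (by ring))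
        (fun r hr => mul_nonneg (h.nonnegC r (hs'.trans hr)) (by
          have m1 : φ r ≤ φ s := φanti hs' (mem_Ici.2 (hs'.trans hr)) hr
          have m2 : α s ≤ α r := monotoneOn_of_hasDerivWithinAt dα h.nonnegA hs'
            (mem_Ici.2 (hs'.trans hr)) hr
          nlinarith [mul_le_mul_of_nonneg_left m1 (α0 s hs'),
            mul_le_mul_of_nonneg_left m2 (φpos s hs').le]))
        (mem_Ici.2 le_rfl) (mem_Ici.2 hr) hr
      simp only at this
      have b1 : κ r - κ s ≤ 1 / 2 := by
        linarith [κle r (hs'.trans hr), κmono ht (mem_Ici.2 hs') hs]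
      nlinarith [mul_le_mul_of_nonneg_left b1 (φpos s hs').le]
    refine le_of_forall_pos_le_add fun ε hε => ?_
    obtain ⟨r, hr1, hr2⟩ := ((ηsmall (ε / (α s + 1)) (div_pos hε (by linarith [α0 s hs']))).and
      (eventually_ge_atTop s)).exists
    have hpos : 0 < α s + 1 := by linarith [α0 s hs']
    have e1 : α s * -η r ≤ α s * (ε / (α s + 1)) := mul_le_mul_of_nonneg_left hr1.le (α0 s hs')
    have e2 : (α s + 1) * (ε / (α s + 1)) = ε := mul_div_cancel₀ _ hpos.ne'
    have e3 := div_pos hε hpos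
    linarith [key r hr2, add_mul (α s) 1 (ε / (α s + 1)), mul_comm (α s) (-η s)]
  -- Monotonicity of φ - η α + φ(t) κ gives φ(s) - η(s) α(s) ≥ φ(t) / 2, whose left side is at most
  -- 3 φ(s) / 2.
  have hlate : ∀ s, t ≤ s → φ t / 3 ≤ φ s := fun s hs => by
    have := monotoneOn_of_hasDerivWithinAt (t₀ := t)
      (f := fun s => φ s - η s * α s + φ t * κ s)
      (f' := fun s => C s * α s * (φ t - φ s))
      (fun s hs => ((((hsol.left s (ht.trans hs)).fun_sub ((hsol.right s (ht.trans hs)).fun_mul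
        (dα s (ht.trans hs)))).fun_add ((dκ s (ht.trans hs)).const_mul (φ t))).mono
          (Ici_subset_Ici.2 ht)).congr_deriv (by ring))
      (fun s hs => mul_nonneg (mul_nonneg (h.nonnegC s (ht.trans hs)) (α0 s (ht.trans hs)))
        (sub_nonneg.2 (φanti ht (mem_Ici.2 (ht.trans hs)) hs)))
      (mem_Ici.2 le_rfl) (mem_Ici.2 hs) hs
    simp only at this
    have b1 : κ s - κ t ≤ 1 / 2 := by linarith [κle s (ht.trans hs)]
    have b2 := mul_le_mul_of_nonneg_left b1 (φpos t ht).le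
    have b3 : 0 ≤ -η t * α t := mul_nonneg (by linarith [hneg t ht]) (α0 t ht)
    linarith [hαη2 s hs, mul_sub (φ t) (κ s) (κ t)]
  refine ⟨φ t / 3, by linarith [φpos t ht], fun s hs => ?_⟩
  exact (hlate _ (le_max_right s t)).trans
    (φanti hs (mem_Ici.2 (hs.trans (le_max_left _ _))) (le_max_left _ _))

/-- Admissibility of `y` when `1 + y ∫ A` stays positive. -/
theorem mem_admissible_of_integral (F : Fundamental A C t₀ φ₁ η₁ φ₂ η₂) (h : LinCoeff A C t₀)
    (hy : ∀ t, t₀ ≤ t → 0 < 1 + y * ∫ τ in t₀..t, A τ) : y ∈ admissible φ₁ φ₂ t₀ := by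
  intro t ht
  have φ1 : ∀ t, t₀ ≤ t → 1 ≤ φ₁ t := fun t ht => F.φ₁_ge_one h ht
  -- By the Wronskian, (φ₂ / φ₁)' = A / φ₁² ≤ A, hence φ₂ ≤ φ₁ ∫ A.
  have := monotoneOn_of_hasDerivWithinAt (f := fun t => (∫ τ in t₀..t, A τ) - φ₂ t / φ₁ t)
    (f' := fun t => A t * (1 - 1 / φ₁ t ^ 2))
    (fun t ht => by
      have hne : φ₁ t ≠ 0 := (zero_lt_one.trans_le (φ1 t ht)).ne'
      refine ((hasDerivWithinAt_integral h.contA ht).fun_sub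
        ((F.sol₂.left t ht).fun_div (F.sol₁.left t ht) hne)).congr_deriv ?_
      field_simp
      linear_combination (-A t) * F.wronskian ht)
    (fun t ht => mul_nonneg (h.nonnegA t ht) (sub_nonneg.2
      (div_le_one_of_le₀ (one_le_pow₀ (φ1 t ht)) (by positivity))))
    (mem_Ici.2 le_rfl) ht ht
  simp only [intervalIntegral.integral_same, F.φ₂_init, zero_div, sub_zero] at this
  have p1 := zero_lt_one.trans_le (φ1 t ht)
  rw [sub_nonneg, div_le_iff₀ p1] at this
  rcases le_total 0 y with h0 | h0
  · exact F.nonneg_mem_admissible h h0 t ht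
  · nlinarith [mul_pos (hy t ht) p1, mul_le_mul_of_nonpos_left this h0]

end Extremal

end Fundamental

/-! ### Improper integrals as limits of real integrals. -/

section ImproperIntegrals

variable {f : ℝ → ℝ} {t₀ : ℝ} {L : EReal}

theorem HasImproperIntegral.neg (h : HasImproperIntegral f t₀ L) :
    HasImproperIntegral (fun t => -f t) t₀ (-L) := by
  have := (continuous_neg.tendsto L).comp h
  refine this.congr fun t => ?_
  simp only [Function.comp_apply, intervalIntegral.integral_neg, EReal.coe_neg]

theorem hasImproperIntegral_top_iff :
    HasImproperIntegral f t₀ ⊤ ↔ Tendsto (fun t => ∫ τ in t₀..t, f τ) atTop atTop :=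
  EReal.tendsto_coe_nhds_top_iff

theorem hasImproperIntegral_bot_iff :
    HasImproperIntegral f t₀ ⊥ ↔ Tendsto (fun t => ∫ τ in t₀..t, f τ) atTop atBot :=
  EReal.tendsto_coe_nhds_bot_iff

theorem hasImproperIntegral_coe_iff {l : ℝ} :
    HasImproperIntegral f t₀ l ↔ Tendsto (fun t => ∫ τ in t₀..t, f τ) atTop (𝓝 l) :=
  EReal.tendsto_coe

theorem integral_le_improperIntegral (hf : ContinuousOn f (Ici t₀))
    (h0 : ∀ t, t₀ ≤ t → 0 ≤ f t) {t : ℝ} (ht : t₀ ≤ t) :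
    ((∫ τ in t₀..t, f τ : ℝ) : EReal) ≤ improperIntegral f t₀ := by
  refine ge_of_tendsto (hasImproperIntegral_of_nonneg hf h0)
    ((eventually_ge_atTop t).mono fun s hs => EReal.coe_le_coe_iff.2 ?_)
  exact monotoneOn_of_hasDerivWithinAt (fun t ht => hasDerivWithinAt_integral hf ht) h0
    ht (mem_Ici.2 (ht.trans hs)) hs

theorem tendsto_integral_atTop (hf : ContinuousOn f (Ici t₀))
    (h0 : ∀ t, t₀ ≤ t → 0 ≤ f t) (h : improperIntegral f t₀ = ⊤) :
    Tendsto (fun t => ∫ τ in t₀..t, f τ) atTop atTop :=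
  hasImproperIntegral_top_iff.1 (h ▸ hasImproperIntegral_of_nonneg hf h0)

theorem tendsto_integral_nhds (hf : ContinuousOn f (Ici t₀))
    (h0 : ∀ t, t₀ ≤ t → 0 ≤ f t) (h : improperIntegral f t₀ < ⊤) :
    ∃ k : ℝ, Tendsto (fun t => ∫ τ in t₀..t, f τ) atTop (𝓝 k) ∧
      ∀ t, t₀ ≤ t → ∫ τ in t₀..t, f τ ≤ k := by
  have hle := fun t ht => integral_le_improperIntegral hf h0 (t := t) ht
  have hbot : improperIntegral f t₀ ≠ ⊥ :=
    ((EReal.bot_lt_coe _).trans_le (hle t₀ le_rfl)).ne'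
  have hcoe := EReal.coe_toReal h.ne hbot
  refine ⟨(improperIntegral f t₀).toReal, hasImproperIntegral_coe_iff.1 ?_, fun t ht => ?_⟩
  · rw [hcoe]
    exact hasImproperIntegral_of_nonneg hf h0
  · rw [← EReal.coe_le_coe_iff, hcoe]
    exact hle t ht

end ImproperIntegrals

/-! ### Sign patterns of monotone functions, from the least and greatest zeros. -/

section SignChange

variable {t₀ T : ℝ} {f : ℝ → ℝ}

theorem pos_of_gt_sSup_zeros (hmono : MonotoneOn f (Ici t₀)) (hpos : 0 < f T) {z : ℝ}
    (hz : z ∈ Icc t₀ T ∩ f ⁻¹' {0}) (hle : ∀ t ∈ Icc t₀ T ∩ f ⁻¹' {0}, t ≤ z) {t : ℝ}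
    (ht : z < t) : 0 < f t := by
  have ht0 : t₀ ≤ t := hz.1.1.trans ht.le
  rcases le_total t T with htT | htT
  · have h0 : f z ≤ f t := hmono hz.1.1 ht0 ht.le
    rw [show f z = 0 from hz.2] at h0
    exact h0.lt_of_ne fun heq => (hle t ⟨⟨ht0, htT⟩, heq.symm⟩).not_gt ht
  · exact hpos.trans_le (hmono (mem_Ici.2 (hz.1.1.trans hz.1.2)) ht0 htT)

theorem isCompact_zeros (hf : ContinuousOn f (Ici t₀)) :
    IsCompact (Icc t₀ T ∩ f ⁻¹' {0}) :=
  isCompact_Icc.of_isClosed_subset ((hf.mono Icc_subset_Ici_self).preimage_isClosed_of_isClosed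
    isClosed_Icc isClosed_singleton) inter_subset_left

theorem changesSign_of_monotoneOn (hf : ContinuousOn f (Ici t₀)) (hmono : MonotoneOn f (Ici t₀))
    (hneg : f t₀ < 0) (hT : t₀ ≤ T) (hpos : 0 < f T) : ChangesSign t₀ f := by
  have hcomp := isCompact_zeros (T := T) hf
  have hne : (Icc t₀ T ∩ f ⁻¹' {0}).Nonempty := by
    obtain ⟨z, hz, hz0⟩ := intermediate_value_Icc hT (hf.mono Icc_subset_Ici_self)
      (show (0 : ℝ) ∈ Icc (f t₀) (f T) from ⟨hneg.le, hpos.le⟩)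
    exact ⟨z, hz, hz0⟩
  obtain ⟨t₁, h₁, hle₁⟩ := hcomp.exists_isLeast hne
  obtain ⟨t₂, h₂, hle₂⟩ := hcomp.exists_isGreatest hne
  have hz₁ : f t₁ = 0 := h₁.2
  have hz₂ : f t₂ = 0 := h₂.2
  refine ⟨t₁, t₂, h₁.1.1.lt_of_ne fun heq => ?_, hle₁ h₂, fun t ht => ?_, fun t ht => ?_,
    fun t ht => pos_of_gt_sSup_zeros hmono hpos h₂ hle₂ ht⟩
  · rw [heq, hz₁] at hneg
    exact lt_irrefl _ hneg
  · have h0 : f t ≤ f t₁ := hmono ht.1 h₁.1.1 ht.2.le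
    rw [hz₁] at h0
    exact h0.lt_of_ne fun heq => (hle₁ ⟨⟨ht.1, ht.2.le.trans h₁.1.2⟩, heq⟩).not_gt ht.2
  · have ht0 : t₀ ≤ t := h₁.1.1.trans ht.1
    exact le_antisymm ((hmono ht0 h₂.1.1 ht.2).trans_eq hz₂)
      (hz₁.symm.trans_le (hmono h₁.1.1 ht0 ht.1))

theorem exists_zero_then_pos (hf : ContinuousOn f (Ici t₀)) (hmono : MonotoneOn f (Ici t₀))
    (hzero : f t₀ = 0) (hT : t₀ ≤ T) (hpos : 0 < f T) :
    ∃ t₁, t₀ ≤ t₁ ∧ (∀ t ∈ Icc t₀ t₁, f t = 0) ∧ ∀ t ∈ Ioi t₁, 0 < f t := by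
  obtain ⟨t₁, h₁, hle₁⟩ := (isCompact_zeros (T := T) hf).exists_isGreatest
    ⟨t₀, ⟨le_rfl, hT⟩, hzero⟩
  have hz₁ : f t₁ = 0 := h₁.2
  exact ⟨t₁, h₁.1.1, fun t ht => le_antisymm ((hmono ht.1 h₁.1.1 ht.2).trans_eq hz₁)
    (hzero.symm.trans_le (hmono (mem_Ici.2 le_rfl) ht.1 ht.1)),
    fun t ht => pos_of_gt_sSup_zeros hmono hpos h₁ hle₁ ht⟩

theorem ChangesSign.of_sign_eq {x : ℝ → ℝ} (h : ChangesSign t₀ f)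
    (hneg : ∀ t, t₀ ≤ t → f t < 0 → x t < 0) (hzero : ∀ t, t₀ ≤ t → f t = 0 → x t = 0)
    (hpos : ∀ t, t₀ ≤ t → 0 < f t → 0 < x t) : ChangesSign t₀ x := by
  obtain ⟨t₁, t₂, h₀₁, h₁₂, hn, hz, hp⟩ := h
  exact ⟨t₁, t₂, h₀₁, h₁₂, fun t ht => hneg t ht.1 (hn t ht),
    fun t ht => hzero t (h₀₁.le.trans ht.1) (hz t ht),
    fun t ht => hpos t ((h₀₁.le.trans h₁₂).trans (le_of_lt ht)) (hp t ht)⟩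

end SignChange

/-! ### Exponential weights and the coefficients of the linear system. -/

section Exponential

variable {b : ℝ → ℝ} {t₀ : ℝ}

theorem J_pos (b : ℝ → ℝ) (t₀ t : ℝ) : 0 < J b t₀ t := Real.exp_pos _

theorem J_self (b : ℝ → ℝ) (t₀ : ℝ) : J b t₀ t₀ = 1 := by simp [J]

theorem J_neg (b : ℝ → ℝ) (t₀ t : ℝ) : J (-b) t₀ t = (J b t₀ t)⁻¹ := by
  simp [J, intervalIntegral.integral_neg, Real.exp_neg]

theorem J_neg_mul_J (b : ℝ → ℝ) (t₀ t : ℝ) : J (-b) t₀ t * J b t₀ t = 1 := by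
  rw [J_neg, inv_mul_cancel₀ (J_pos b t₀ t).ne']

theorem hasDerivWithinAt_J (hb : ContinuousOn b (Ici t₀)) {t : ℝ} (ht : t₀ ≤ t) :
    HasDerivWithinAt (J b t₀) (b t * J b t₀ t) (Ici t₀) t :=
  (hasDerivWithinAt_integral hb ht).exp.congr_deriv (mul_comm _ _)

theorem J_eq_mul (hb : ContinuousOn b (Ici t₀)) {τ t : ℝ} (hτ : t₀ ≤ τ) (ht : t₀ ≤ t) :
    J (-b) τ t = J (-b) t₀ t * J b t₀ τ := by
  have h := intervalIntegral.integral_add_adjacent_intervals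
    (intervalIntegrable_of_continuousOn_Ici hb le_rfl hτ)
    (intervalIntegrable_of_continuousOn_Ici hb hτ ht)
  simp only [J, Pi.neg_apply, intervalIntegral.integral_neg, ← Real.exp_add]
  congr 1
  linarith

theorem Iminus_eq (hb : ContinuousOn b (Ici t₀)) (c : ℝ → ℝ) {t : ℝ} (ht : t₀ ≤ t) :
    Iminus b c t₀ t = J (-b) t₀ t * ∫ τ in t₀..t, c τ * J b t₀ τ := by
  rw [Iminus, ← intervalIntegral.integral_const_mul]
  refine intervalIntegral.integral_congr fun τ hτ => ?_
  rw [uIcc_of_le ht] at hτ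
  simp only [J_eq_mul hb hτ.1 ht]
  ring

end Exponential

/-- The coefficient `a(t) J_{-b}(t₀; t)` of the linear system attached to a Riccati equation. -/
noncomputable def linCoef (a b : ℝ → ℝ) (t₀ : ℝ) : ℝ → ℝ := fun τ => a τ * J (-b) t₀ τ

/-- The standing assumptions on the coefficients of the Riccati equation. -/
structure Coeff (a b c : ℝ → ℝ) (t₀ : ℝ) : Prop where
  conta : ContinuousOn a (Ici t₀)
  contb : ContinuousOn b (Ici t₀)
  contc : ContinuousOn c (Ici t₀)
  suppa : UnboundedSupport a t₀
  suppc : UnboundedSupport c t₀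
  nonneg : ∀ t, t₀ ≤ t → 0 ≤ a t
  nonpos : ∀ t, t₀ ≤ t → c t ≤ 0

namespace Coeff

variable {a b c : ℝ → ℝ} {t₀ : ℝ}

/-- The equation for u has the same form, and its linear system is the original one with A and C
exchanged. -/
theorem dual (H : Coeff a b c t₀) : Coeff (-c) (-b) (-a) t₀ where
  conta := H.contc.neg
  contb := H.contb.neg
  contc := H.conta.neg
  suppa T hT := (H.suppc T hT).imp fun _ h => ⟨h.1, neg_ne_zero.2 h.2⟩
  suppc T hT := (H.suppa T hT).imp fun _ h => ⟨h.1, neg_ne_zero.2 h.2⟩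
  nonneg t ht := neg_nonneg.2 (H.nonpos t ht)
  nonpos t ht := neg_nonpos.2 (H.nonneg t ht)

theorem linCoef_continuousOn (H : Coeff a b c t₀) : ContinuousOn (linCoef a b t₀) (Ici t₀) :=
  H.conta.mul (continuousOn_of_hasDerivWithinAt fun _ ht => hasDerivWithinAt_J H.contb.neg ht)

theorem linCoef_nonneg (H : Coeff a b c t₀) (t : ℝ) (ht : t₀ ≤ t) : 0 ≤ linCoef a b t₀ t :=
  mul_nonneg (H.nonneg t ht) (J_pos _ _ _).le

theorem linCoef_supp (H : Coeff a b c t₀) : UnboundedSupport (linCoef a b t₀) t₀ := fun T hT =>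
  (H.suppa T hT).imp fun _ h => ⟨h.1, mul_ne_zero h.2 (J_pos _ _ _).ne'⟩

theorem linCoeff (H : Coeff a b c t₀) :
    LinCoeff (linCoef a b t₀) (linCoef (-c) (-b) t₀) t₀ where
  contA := H.linCoef_continuousOn
  contC := H.dual.linCoef_continuousOn
  nonnegA := H.linCoef_nonneg
  nonnegC := H.dual.linCoef_nonneg
  suppA := H.linCoef_supp
  suppC := H.dual.linCoef_supp

theorem tendsto_left (H : Coeff a b c t₀) (h : IplusInf a b t₀ = ⊤) :
    Tendsto (fun t => ∫ τ in t₀..t, linCoef a b t₀ τ) atTop atTop :=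
  tendsto_integral_atTop H.linCoef_continuousOn H.linCoef_nonneg h

theorem tendsto_right (H : Coeff a b c t₀) (h : IplusInf c (-b) t₀ = ⊥) :
    Tendsto (fun t => ∫ τ in t₀..t, linCoef (-c) (-b) t₀ τ) atTop atTop := by
  have h1 := hasImproperIntegral_of_nonneg H.dual.linCoef_continuousOn H.dual.linCoef_nonneg
  have h2 := h1.neg.improperIntegral_eq
  have h3 : (fun t => -linCoef (-c) (-b) t₀ t) = fun τ => c τ * J (-(-b)) t₀ τ := by
    funext t
    simp [linCoef]
  rw [h3] at h2
  rw [IplusInf, h2, EReal.neg_eq_bot_iff] at h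
  exact hasImproperIntegral_top_iff.1 (h ▸ h1)

end Coeff

/-! ### Dictionary between the Riccati equation and the linear system. -/

section Correspondence

variable {a b c φ₁ η₁ φ₂ η₂ x : ℝ → ℝ} {t₀ : ℝ}

/-- A regular solution of the Riccati equation is `J_{-b} η / φ` for the solution `(φ, η)` of the
linear system with `φ = exp (∫ a x)`. -/
theorem IsRegular.eq_quotient (H : Coeff a b c t₀)
    (F : Fundamental (linCoef a b t₀) (linCoef (-c) (-b) t₀) t₀ φ₁ η₁ φ₂ η₂)
    (hx : IsRegular a b c t₀ x) {t : ℝ} (ht : t₀ ≤ t) :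
    φ₁ t + x t₀ * φ₂ t = Real.exp (∫ τ in t₀..t, a τ * x τ) ∧
      x t = J (-b) t₀ t * ((η₁ t + x t₀ * η₂ t) / (φ₁ t + x t₀ * φ₂ t)) := by
  have cx : ContinuousOn x (Ici t₀) := continuousOn_of_hasDerivWithinAt hx
  have dφ : ∀ t, t₀ ≤ t → HasDerivWithinAt (fun t => Real.exp (∫ τ in t₀..t, a τ * x τ))
      (Real.exp (∫ τ in t₀..t, a τ * x τ) * (a t * x t)) (Ici t₀) t := fun t ht =>
    (hasDerivWithinAt_integral (H.conta.mul cx) ht).exp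
  have s : IsLinSol (linCoef a b t₀) (linCoef (-c) (-b) t₀) t₀
      (fun t => Real.exp (∫ τ in t₀..t, a τ * x τ))
      (fun t => x t * J b t₀ t * Real.exp (∫ τ in t₀..t, a τ * x τ)) := by
    refine ⟨fun t ht => (dφ t ht).congr_deriv ?_, fun t ht =>
      (((hx t ht).fun_mul (hasDerivWithinAt_J H.contb ht)).fun_mul (dφ t ht)).congr_deriv ?_⟩
    · simp only [linCoef]
      linear_combination (-(a t * x t * Real.exp (∫ τ in t₀..t, a τ * x τ))) * J_neg_mul_J b t₀ t
    · simp only [linCoef, neg_neg, Pi.neg_apply]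
      ring
  have e := F.eq_combination s ht
  simp only [intervalIntegral.integral_same, Real.exp_zero, J_self, one_mul, mul_one] at e
  refine ⟨e.1.symm, ?_⟩
  rw [← e.1, ← e.2, mul_div_assoc, div_self (Real.exp_pos _).ne']
  linear_combination (-x t) * J_neg_mul_J b t₀ t

theorem IsRegular.mem_admissible (H : Coeff a b c t₀)
    (F : Fundamental (linCoef a b t₀) (linCoef (-c) (-b) t₀) t₀ φ₁ η₁ φ₂ η₂)
    (hx : IsRegular a b c t₀ x) : x t₀ ∈ admissible φ₁ φ₂ t₀ := fun t ht => by
  rw [(hx.eq_quotient H F ht).1]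
  exact Real.exp_pos _

/-- This turns every claim about ∫ a x into one about the limit of φ. -/
theorem IsRegular.integral_eq_log (H : Coeff a b c t₀)
    (F : Fundamental (linCoef a b t₀) (linCoef (-c) (-b) t₀) t₀ φ₁ η₁ φ₂ η₂)
    (hx : IsRegular a b c t₀ x) {t : ℝ} (ht : t₀ ≤ t) :
    ∫ τ in t₀..t, a τ * x τ = Real.log (φ₁ t + x t₀ * φ₂ t) := by
  rw [(hx.eq_quotient H F ht).1, Real.log_exp]

theorem IsRegular.sign_eq (H : Coeff a b c t₀)
    (F : Fundamental (linCoef a b t₀) (linCoef (-c) (-b) t₀) t₀ φ₁ η₁ φ₂ η₂)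
    (hx : IsRegular a b c t₀ x) {t : ℝ} (ht : t₀ ≤ t) :
    (η₁ t + x t₀ * η₂ t < 0 → x t < 0) ∧ (η₁ t + x t₀ * η₂ t = 0 → x t = 0) ∧
      (0 < η₁ t + x t₀ * η₂ t → 0 < x t) := by
  have p := hx.mem_admissible H F t ht
  rw [(hx.eq_quotient H F ht).2]
  exact ⟨fun h => mul_neg_of_pos_of_neg (J_pos _ _ _) (div_neg_of_neg_of_pos h p),
    fun h => by rw [h, zero_div, mul_zero], fun h => mul_pos (J_pos _ _ _) (div_pos h p)⟩

theorem exists_isRegular (H : Coeff a b c t₀)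
    (F : Fundamental (linCoef a b t₀) (linCoef (-c) (-b) t₀) t₀ φ₁ η₁ φ₂ η₂) {y : ℝ}
    (hy : y ∈ admissible φ₁ φ₂ t₀) : ∃ x, IsRegular a b c t₀ x ∧ x t₀ = y := by
  refine ⟨fun t => J (-b) t₀ t * ((η₁ t + y * η₂ t) / (φ₁ t + y * φ₂ t)), fun t ht => ?_, ?_⟩
  · have p := (hy t ht).ne'
    refine ((hasDerivWithinAt_J H.contb.neg ht).fun_mul
      (((F.sol y).right t ht).fun_div ((F.sol y).left t ht) p)).congr_deriv ?_
    have hJ := J_neg_mul_J b t₀ t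
    simp only [linCoef, neg_neg, Pi.neg_apply]
    field_simp
    linear_combination (-c t * (φ₁ t + y * φ₂ t) ^ 2) * hJ
  · simp only [(F.init y).1, (F.init y).2, J_self, div_one, one_mul]

theorem IsRegular.eqOn {z : ℝ → ℝ} (H : Coeff a b c t₀) (hx : IsRegular a b c t₀ x)
    (hz : IsRegular a b c t₀ z) (h : x t₀ = z t₀) : EqOn x z (Ici t₀) := fun t ht => by
  obtain ⟨φ₁, η₁, φ₂, η₂, F⟩ := H.linCoeff.exists_fundamental
  rw [(hx.eq_quotient H F ht).2, (hz.eq_quotient H F ht).2, h]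

theorem IsRegular.changesSign (H : Coeff a b c t₀)
    (F : Fundamental (linCoef a b t₀) (linCoef (-c) (-b) t₀) t₀ φ₁ η₁ φ₂ η₂)
    (hx : IsRegular a b c t₀ x) (hneg : x t₀ < 0)
    (hpos : ∃ t, t₀ ≤ t ∧ 0 < η₁ t + x t₀ * η₂ t) : ChangesSign t₀ x := by
  obtain ⟨T, hT, hpos⟩ := hpos
  have hadm := hx.mem_admissible H F
  refine (changesSign_of_monotoneOn (F.sol (x t₀)).swap.continuousOn_left
    (H.linCoeff.right_monotoneOn (F.sol (x t₀)) fun t ht => (hadm t ht).le)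
    (by rwa [(F.init (x t₀)).2]) hT hpos).of_sign_eq (fun t ht => (hx.sign_eq H F ht).1)
    (fun t ht => (hx.sign_eq H F ht).2.1) (fun t ht => (hx.sign_eq H F ht).2.2)

/-- The regular initial values fill [y₀, ∞), and normality singles out its interior. -/
theorem IsRegular.isNormal_iff (H : Coeff a b c t₀)
    (F : Fundamental (linCoef a b t₀) (linCoef (-c) (-b) t₀) t₀ φ₁ η₁ φ₂ η₂) {y₀ : ℝ}
    (hS : ∀ y, y ∈ admissible φ₁ φ₂ t₀ ↔ y₀ ≤ y) (hx : IsRegular a b c t₀ x) :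
    IsNormal a b c t₀ x ↔ y₀ < x t₀ := by
  constructor
  · rintro ⟨-, U, hU, hreg⟩
    obtain ⟨l, u, hlu, hsub⟩ := mem_nhds_iff_exists_Ioo_subset.1 hU
    obtain ⟨y, hly, hyx⟩ := exists_between hlu.1
    obtain ⟨z, hz, rfl⟩ := hreg y (hsub ⟨hly, hyx.trans hlu.2⟩)
    exact ((hS _).1 (hz.mem_admissible H F)).trans_lt hyx
  · exact fun h => ⟨hx, Ioi y₀, Ioi_mem_nhds h, fun y hy =>
      exists_isRegular H F ((hS y).2 (le_of_lt hy))⟩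

/-- The solution started at `y` stays between the solutions of `z' + a z² + b z = 0` and
`z' + b z + c = 0` started at `y`. -/
theorem IsRegular.bounds (H : Coeff a b c t₀)
    (F : Fundamental (linCoef a b t₀) (linCoef (-c) (-b) t₀) t₀ φ₁ η₁ φ₂ η₂)
    (hx : IsRegular a b c t₀ x)
    (hpos : ∀ t, t₀ ≤ t → 0 < 1 + x t₀ * ∫ τ in t₀..t, linCoef a b t₀ τ) {t : ℝ} (ht : t₀ ≤ t) :
    x t₀ * J (-b) t₀ t / (1 + x t₀ * Iplus a b t₀ t) ≤ x t ∧
      x t ≤ x t₀ * J (-b) t₀ t - Iminus b c t₀ t := by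
  have h := H.linCoeff
  have hadm := hx.mem_admissible H F
  have s := F.sol (x t₀)
  have i := F.init (x t₀)
  have hJ := J_pos (-b) t₀ t
  rw [(hx.eq_quotient H F ht).2]
  set y := x t₀
  constructor
  -- The lower bound with denominators cleared: η (1 + y ∫ A) - y φ starts at 0 and has derivative C
  -- φ (1 + y ∫ A).
  · have key := monotoneOn_of_hasDerivWithinAt
      (f := fun t => (η₁ t + y * η₂ t) * (1 + y * ∫ τ in t₀..t, linCoef a b t₀ τ)
        - y * (φ₁ t + y * φ₂ t))
      (f' := fun t => linCoef (-c) (-b) t₀ t * (φ₁ t + y * φ₂ t) *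
        (1 + y * ∫ τ in t₀..t, linCoef a b t₀ τ))
      (fun t ht => (((s.right t ht).fun_mul (((hasDerivWithinAt_integral h.contA ht).const_mul
        y).const_add 1)).fun_sub ((s.left t ht).const_mul y)).congr_deriv (by ring))
      (fun t ht => mul_nonneg (mul_nonneg (h.nonnegC t ht) (hadm t ht).le) (hpos t ht).le)
      (mem_Ici.2 le_rfl) ht ht
    simp only [i.1, i.2, intervalIntegral.integral_same] at key
    have h1 : y / (1 + y * Iplus a b t₀ t) ≤ (η₁ t + y * η₂ t) / (φ₁ t + y * φ₂ t) := by
      have e : Iplus a b t₀ t = ∫ τ in t₀..t, linCoef a b t₀ τ := rfl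
      rw [e, div_le_div_iff₀ (hpos t ht) (hadm t ht)]
      linarith
    calc y * J (-b) t₀ t / (1 + y * Iplus a b t₀ t)
        = J (-b) t₀ t * (y / (1 + y * Iplus a b t₀ t)) := by ring
      _ ≤ _ := mul_le_mul_of_nonneg_left h1 hJ.le
  -- The quotient satisfies (η / φ)' = C - A (η / φ)² ≤ C.
  · have key := monotoneOn_of_hasDerivWithinAt
      (f := fun t => (∫ τ in t₀..t, linCoef (-c) (-b) t₀ τ)
        - (η₁ t + y * η₂ t) / (φ₁ t + y * φ₂ t))
      (f' := fun t => linCoef a b t₀ t * ((η₁ t + y * η₂ t) / (φ₁ t + y * φ₂ t)) ^ 2)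
      (fun t ht => ((hasDerivWithinAt_integral h.contC ht).fun_sub
        ((s.right t ht).fun_div (s.left t ht) (hadm t ht).ne')).congr_deriv (by
          have := (hadm t ht).ne'
          field_simp
          ring))
      (fun t ht => mul_nonneg (h.nonnegA t ht) (sq_nonneg _)) (mem_Ici.2 le_rfl) ht ht
    simp only [i.1, i.2, intervalIntegral.integral_same, div_one] at key
    have e : (∫ τ in t₀..t, linCoef (-c) (-b) t₀ τ) = -∫ τ in t₀..t, c τ * J b t₀ τ := by
      simp [linCoef, intervalIntegral.integral_neg]
    rw [Iminus_eq H.contb c ht]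
    have := mul_le_mul_of_nonneg_left (show (η₁ t + y * η₂ t) / (φ₁ t + y * φ₂ t) ≤
      y - ∫ τ in t₀..t, c τ * J b t₀ τ by linarith) hJ.le
    linarith [mul_sub (J (-b) t₀ t) y (∫ τ in t₀..t, c τ * J b t₀ τ)]

theorem one_add_mul_integral_pos (H : Coeff a b c t₀) {y : ℝ}
    (hy : -(1 / IplusInf a b t₀) ≤ (y : EReal)) {t : ℝ} (ht : t₀ ≤ t) :
    0 < 1 + y * ∫ τ in t₀..t, linCoef a b t₀ τ := by
  have hα := integral_nonneg_of_nonneg_Ici H.linCoef_nonneg le_rfl ht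
  rcases le_or_gt 0 y with h0 | h0
  · positivity
  have hle : ∀ s, t₀ ≤ s → ((∫ τ in t₀..s, linCoef a b t₀ τ : ℝ) : EReal) ≤ IplusInf a b t₀ :=
    fun s hs => integral_le_improperIntegral H.linCoef_continuousOn H.linCoef_nonneg hs
  rcases (le_top : IplusInf a b t₀ ≤ ⊤).eq_or_lt with htop | hlt
  · rw [htop, EReal.div_top, neg_zero] at hy
    exact absurd (EReal.coe_nonneg.1 hy) (not_le.2 h0)
  have hcoe := EReal.coe_toReal hlt.ne
    ((EReal.bot_lt_coe _).trans_le (hle t₀ le_rfl)).ne'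
  rw [← hcoe] at hle hy
  set e := (IplusInf a b t₀).toReal
  -- The unbounded support puts ∫ A up to t strictly below its limit e, so positivity is strict even
  -- at y = -1 / e.
  obtain ⟨s, hts, hs⟩ := exists_integral_pos H.linCoef_continuousOn H.linCoef_nonneg
    H.linCoef_supp ht
  have hadd := intervalIntegral.integral_add_adjacent_intervals
    (intervalIntegrable_of_continuousOn_Ici H.linCoef_continuousOn le_rfl ht)
    (intervalIntegrable_of_continuousOn_Ici H.linCoef_continuousOn ht (ht.trans hts))
  have hes := EReal.coe_le_coe_iff.1 (hle s (ht.trans hts))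
  have he : 0 < e := by linarith
  have hy' : -(1 / e) ≤ y := by
    rw [← EReal.coe_one, ← EReal.coe_div] at hy
    exact_mod_cast hy
  have h1 : -1 ≤ y * e := by
    have := mul_le_mul_of_nonneg_right hy' he.le
    rwa [neg_mul, one_div, inv_mul_cancel₀ he.ne'] at this
  nlinarith

end Correspondence

/-! ### Assembly of the assertions. -/

section Main

variable {a b c : ℝ → ℝ} {t₀ : ℝ}

theorem solutionFrom_of_ge (H : Coeff a b c t₀) {y : ℝ}
    (hy : -(1 / IplusInf a b t₀) ≤ (y : EReal)) :
    SolutionFrom a b c t₀ y fun x =>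
      (∀ t, t₀ ≤ t →
        y * J (-b) t₀ t / (1 + y * Iplus a b t₀ t) ≤ x t ∧
        x t ≤ y * J (-b) t₀ t - Iminus b c t₀ t) ∧
      (y = 0 → ∃ t₁, t₀ ≤ t₁ ∧ (∀ t ∈ Icc t₀ t₁, x t = 0) ∧ ∀ t ∈ Ioi t₁, 0 < x t) ∧
      (0 < y → ∀ t, t₀ ≤ t → 0 < x t) := by
  obtain ⟨φ₁, η₁, φ₂, η₂, F⟩ := H.linCoeff.exists_fundamental
  have hpos := fun t ht => one_add_mul_integral_pos H hy (t := t) ht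
  refine ⟨exists_isRegular H F (F.mem_admissible_of_integral H.linCoeff hpos), ?_⟩
  rintro x hx rfl
  have hadm := hx.mem_admissible H F
  have s := F.sol (x t₀)
  have hmono := H.linCoeff.right_monotoneOn s fun t ht => (hadm t ht).le
  refine ⟨fun t ht => hx.bounds H F hpos ht, fun h0 => ?_, fun h0 t ht => ?_⟩
  · obtain ⟨T, hT, hη⟩ := F.exists_η_pos H.linCoeff hadm le_rfl
      (by rw [(F.init (x t₀)).2, h0])
    obtain ⟨t₁, h₁, hz, hp⟩ := exists_zero_then_pos s.swap.continuousOn_left hmono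
      (by rw [(F.init (x t₀)).2, h0]) hT hη
    exact ⟨t₁, h₁, fun t ht => (hx.sign_eq H F ht.1).2.1 (hz t ht),
      fun t ht => (hx.sign_eq H F (h₁.trans (le_of_lt ht))).2.2 (hp t ht)⟩
  · refine (hx.sign_eq H F ht).2.2 (lt_of_lt_of_le ?_ (hmono (mem_Ici.2 le_rfl) ht ht))
    simpa only [(F.init (x t₀)).2] using h0

theorem exists_isUniqueExtremal (H : Coeff a b c t₀)
    {φ₁ η₁ φ₂ η₂ : ℝ → ℝ}
    (F : Fundamental (linCoef a b t₀) (linCoef (-c) (-b) t₀) t₀ φ₁ η₁ φ₂ η₂) :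
    ∃ xs, IsUniqueExtremal a b c t₀ xs ∧ xs t₀ < 0 ∧
      (∀ y, y ∈ admissible φ₁ φ₂ t₀ ↔ xs t₀ ≤ y) ∧
      ∀ t, t₀ ≤ t → η₁ t + xs t₀ * η₂ t < 0 := by
  obtain ⟨y₀, hy₀, hS, hneg⟩ := F.exists_extremal_value H.linCoeff
  obtain ⟨xs, hxs, rfl⟩ := exists_isRegular H F ((hS y₀).2 le_rfl)
  refine ⟨xs, ⟨⟨hxs, fun hN => lt_irrefl _ ((hxs.isNormal_iff H F hS).1 hN)⟩, fun z hz => ?_⟩,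
    hy₀, hS, hneg⟩
  refine hz.1.eqOn H hxs (le_antisymm (not_lt.1 fun h => ?_) ((hS _).1 (hz.1.mem_admissible H F)))
  exact hz.2 ((hz.1.isNormal_iff H F hS).2 h)

theorem hasImproperIntegral_extremal_bot (H : Coeff a b c t₀)
    {φ₁ η₁ φ₂ η₂ xs : ℝ → ℝ}
    (F : Fundamental (linCoef a b t₀) (linCoef (-c) (-b) t₀) t₀ φ₁ η₁ φ₂ η₂)
    (hxs : IsRegular a b c t₀ xs) (hneg : ∀ t, t₀ ≤ t → η₁ t + xs t₀ * η₂ t < 0)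
    (hγ : Tendsto (fun t => ∫ τ in t₀..t, linCoef (-c) (-b) t₀ τ) atTop atTop) :
    HasImproperIntegral (fun τ => a τ * xs τ) t₀ ⊥ := by
  have hadm := hxs.mem_admissible H F
  refine hasImproperIntegral_bot_iff.2 ((Real.tendsto_log_nhdsGT_zero.comp
    (tendsto_nhdsWithin_iff.2 ⟨F.tendsto_φ_zero H.linCoeff hadm hneg hγ,
      (eventually_ge_atTop t₀).mono fun t ht => hadm t ht⟩)).congr' ?_)
  filter_upwards [eventually_ge_atTop t₀] with t ht using (hxs.integral_eq_log H F ht).symm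

theorem hasImproperIntegral_normal_top (H : Coeff a b c t₀)
    {φ₁ η₁ φ₂ η₂ x : ℝ → ℝ}
    (F : Fundamental (linCoef a b t₀) (linCoef (-c) (-b) t₀) t₀ φ₁ η₁ φ₂ η₂) {y₀ : ℝ}
    (hy₀ : y₀ ∈ admissible φ₁ φ₂ t₀) (hx : IsRegular a b c t₀ x) (hlt : y₀ < x t₀)
    (hα : Tendsto (fun t => ∫ τ in t₀..t, linCoef a b t₀ τ) atTop atTop) :
    HasImproperIntegral (fun τ => a τ * x τ) t₀ ⊤ := by
  refine hasImproperIntegral_top_iff.2 ((Real.tendsto_log_atTop.comp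
    (F.tendsto_φ_atTop H.linCoeff hy₀ hlt hα)).congr' ?_)
  filter_upwards [eventually_ge_atTop t₀] with t ht using (hx.integral_eq_log H F ht).symm

theorem hasImproperIntegral_extremal_finite (H : Coeff a b c t₀)
    {φ₁ η₁ φ₂ η₂ xs : ℝ → ℝ}
    (F : Fundamental (linCoef a b t₀) (linCoef (-c) (-b) t₀) t₀ φ₁ η₁ φ₂ η₂)
    (hxs : IsRegular a b c t₀ xs) (hneg : ∀ t, t₀ ≤ t → η₁ t + xs t₀ * η₂ t < 0)
    (hα : Tendsto (fun t => ∫ τ in t₀..t, linCoef a b t₀ τ) atTop atTop)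
    (hfin : improperIntegral (fun τ => |c τ| * Iminus (-b) a t₀ τ) t₀ < ⊤) :
    ∃ L : ℝ, HasImproperIntegral (fun τ => a τ * xs τ) t₀ L := by
  have hadm := hxs.mem_admissible H F
  have h := H.linCoeff
  -- The integrand in the hypothesis is C (∫ A), as `exists_φ_ge` requires.
  have heq : ∀ τ ∈ Ici t₀, |c τ| * Iminus (-b) a t₀ τ =
      linCoef (-c) (-b) t₀ τ * ∫ σ in t₀..τ, linCoef a b t₀ σ := fun τ hτ => by
    rw [Iminus_eq H.contb.neg a hτ, abs_of_nonpos (H.nonpos τ hτ)]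
    simp only [linCoef, Pi.neg_apply]
    ring
  have hcont : ContinuousOn (fun τ => linCoef (-c) (-b) t₀ τ *
      ∫ σ in t₀..τ, linCoef a b t₀ σ) (Ici t₀) :=
    h.contC.mul (continuousOn_of_hasDerivWithinAt fun t ht => hasDerivWithinAt_integral h.contA ht)
  obtain ⟨k, hk, -⟩ := tendsto_integral_nhds (hcont.congr heq) (fun t ht => by
    rw [heq t ht]
    exact mul_nonneg (h.nonnegC t ht) (integral_nonneg_of_nonneg_Ici h.nonnegA le_rfl ht)) hfin
  have hk' : Tendsto (fun t => ∫ τ in t₀..t, linCoef (-c) (-b) t₀ τ *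
      ∫ σ in t₀..τ, linCoef a b t₀ σ) atTop (𝓝 k) := by
    refine hk.congr' ?_
    filter_upwards [eventually_ge_atTop t₀] with t ht
    refine intervalIntegral.integral_congr fun τ hτ => heq τ ?_
    rw [uIcc_of_le ht] at hτ
    exact hτ.1
  obtain ⟨m, hm, hge⟩ := F.exists_φ_ge h hadm hneg hα hk'
  have hanti : AntitoneOn (fun t => φ₁ t + xs t₀ * φ₂ t) (Ici t₀) :=
    h.left_antitoneOn (F.sol (xs t₀)) fun t ht => (hneg t ht).le
  -- φ is decreasing and bounded below by m > 0, so log φ has a finite limit.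
  have hanti' : Antitone fun t => φ₁ (max t₀ t) + xs t₀ * φ₂ (max t₀ t) := fun s t hst =>
    hanti (mem_Ici.2 (le_max_left _ _)) (mem_Ici.2 (le_max_left _ _)) (max_le_max le_rfl hst)
  have hbdd : BddBelow (range fun t => φ₁ (max t₀ t) + xs t₀ * φ₂ (max t₀ t)) :=
    ⟨m, by rintro _ ⟨t, rfl⟩; exact hge _ (le_max_left _ _)⟩
  have hlim := tendsto_atTop_ciInf hanti' hbdd
  set l := ⨅ t, (φ₁ (max t₀ t) + xs t₀ * φ₂ (max t₀ t))
  have hl : 0 < l := hm.trans_le (ge_of_tendsto' hlim fun t => hge _ (le_max_left _ _))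
  refine ⟨Real.log l, hasImproperIntegral_coe_iff.2 ((hlim.log hl.ne').congr' ?_)⟩
  filter_upwards [eventually_ge_atTop t₀] with t ht
  rw [max_eq_right ht, hxs.integral_eq_log H F ht]

end Main

end Riccati

theorem theorem2p3 (t₀ : ℝ) (a b c : ℝ → ℝ)
    (ha : ContinuousOn a (Set.Ici t₀)) (hb : ContinuousOn b (Set.Ici t₀))
    (hc : ContinuousOn c (Set.Ici t₀))
    (ha_supp : Riccati.UnboundedSupport a t₀) (hc_supp : Riccati.UnboundedSupport c t₀)
    (ha_nonneg : ∀ t, t₀ ≤ t → 0 ≤ a t) (hc_nonpos : ∀ t, t₀ ≤ t → c t ≤ 0) :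
    -- I (in the extended reals `1 / ⊤ = 0`)
    (∀ y : ℝ, -(1 / Riccati.IplusInf a b t₀) ≤ (y : EReal) →
      Riccati.SolutionFrom a b c t₀ y fun x =>
        (∀ t, t₀ ≤ t →
          y * Riccati.J (-b) t₀ t / (1 + y * Riccati.Iplus a b t₀ t) ≤ x t ∧
          x t ≤ y * Riccati.J (-b) t₀ t - Riccati.Iminus b c t₀ t) ∧
        (y = 0 → ∃ t₁, t₀ ≤ t₁ ∧ (∀ t ∈ Set.Icc t₀ t₁, x t = 0) ∧ ∀ t ∈ Set.Ioi t₁, 0 < x t) ∧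
        (0 < y → ∀ t, t₀ ≤ t → 0 < x t)) ∧
    -- II
    ∃ xs : ℝ → ℝ, Riccati.IsUniqueExtremal a b c t₀ xs ∧ (∀ t, t₀ ≤ t → xs t < 0) ∧
    -- III
    (Riccati.IplusInf a b t₀ = ⊤ ∨ Riccati.IplusInf c (-b) t₀ = ⊥ →
      ∀ y ∈ Set.Ioo (xs t₀) 0,
        Riccati.SolutionFrom a b c t₀ y (Riccati.ChangesSign t₀)) ∧
    -- IV
    (Riccati.IplusInf a b t₀ = ⊤ → ∀ xN, Riccati.IsNormal a b c t₀ xN →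
      Riccati.HasImproperIntegral (fun τ => a τ * xN τ) t₀ ⊤) ∧
    -- V
    (Riccati.IplusInf c (-b) t₀ = ⊥ →
      Riccati.HasImproperIntegral (fun τ => a τ * xs τ) t₀ ⊥) ∧
    -- VI
    (Riccati.IplusInf a b t₀ < ⊤ → Riccati.IplusInf (-c) (-b) t₀ < ⊤ →
      ∃ xN, Riccati.IsNormal a b c t₀ xN ∧ (∀ t, t₀ ≤ t → xN t < 0) ∧
        ∀ y ∈ Set.Ioo (xN t₀) 0,
          Riccati.SolutionFrom a b c t₀ y (Riccati.ChangesSign t₀)) ∧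
    -- VII
    (Riccati.IplusInf a b t₀ = ⊤ →
      Riccati.improperIntegral (fun τ => |c τ| * Riccati.Iminus (-b) a t₀ τ) t₀ < ⊤ →
      (∃ L : ℝ, Riccati.HasImproperIntegral (fun τ => a τ * xs τ) t₀ L) ∧
      ∃ us : ℝ → ℝ, Riccati.IsUniqueExtremal (-c) (-b) (-a) t₀ us ∧
        Riccati.HasImproperIntegral (fun τ => c τ * us τ) t₀ ⊤) := by
  have H : Riccati.Coeff a b c t₀ := ⟨ha, hb, hc, ha_supp, hc_supp, ha_nonneg, hc_nonpos⟩
  have h := H.linCoeff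
  obtain ⟨φ₁, η₁, φ₂, η₂, F⟩ := h.exists_fundamental
  obtain ⟨xs, hxs, -, hS, hneg⟩ := Riccati.exists_isUniqueExtremal H F
  have hreg := hxs.1.1
  have hadm := hreg.mem_admissible H F
  have hchange : ∀ y, xs t₀ ≤ y → y < 0 → (∃ t, t₀ ≤ t ∧ 0 < η₁ t + y * η₂ t) →
      Riccati.SolutionFrom a b c t₀ y (Riccati.ChangesSign t₀) := fun y hy hy0 hpos =>
    ⟨Riccati.exists_isRegular H F ((hS y).2 hy), fun x hx hxy => by
      subst hxy
      exact hx.changesSign H F hy0 hpos⟩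
  refine ⟨fun y hy => Riccati.solutionFrom_of_ge H hy, xs, hxs,
    fun t ht => (hreg.sign_eq H F ht).1 (hneg t ht), fun hdiv y hy => ?_, fun hα xN hN => ?_,
    fun hγ => Riccati.hasImproperIntegral_extremal_bot H F hreg hneg (H.tendsto_right hγ),
    fun hα hγ => ?_, fun hα hfin => ⟨?_, ?_⟩⟩
  · exact hchange y hy.1.le hy.2 (F.exists_η_pos_of_divergent h hadm hy.1
      (hdiv.imp H.tendsto_left H.tendsto_right))
  · exact Riccati.hasImproperIntegral_normal_top H F hadm hN.1
      ((hN.1.isNormal_iff H F hS).1 hN) (H.tendsto_left hα)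
  · obtain ⟨k, -, hk⟩ := Riccati.tendsto_integral_nhds h.contA h.nonnegA hα
    obtain ⟨l, -, hl⟩ := Riccati.tendsto_integral_nhds h.contC h.nonnegC hγ
    obtain ⟨y₁, hy₁, hneg₁, hgt⟩ := F.exists_greatest_negative h hS hneg
      (fun t ht => (hk t ht).trans (le_max_left k l))
      (fun t ht => (hl t ht).trans (le_max_right k l))
    obtain ⟨xN, hxN, rfl⟩ := Riccati.exists_isRegular H F ((hS y₁).2 hy₁.le)
    exact ⟨xN, (hxN.isNormal_iff H F hS).2 hy₁, fun t ht => (hxN.sign_eq H F ht).1 (hneg₁ t ht),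
      fun y hy => hchange y (hy₁.trans hy.1).le hy.2 (hgt y hy.1)⟩
  · exact Riccati.hasImproperIntegral_extremal_finite H F hreg hneg (H.tendsto_left hα) hfin
  -- In the dual system ∫ A plays the role of ∫ C, so its divergence gives ∫ (-c) u = -∞ for the
  -- extremal u.
  · obtain ⟨ψ₁, θ₁, ψ₂, θ₂, G⟩ := H.dual.linCoeff.exists_fundamental
    obtain ⟨us, hus, -, -, hnegu⟩ := Riccati.exists_isUniqueExtremal H.dual G
    refine ⟨us, hus, ?_⟩
    have hbot := (Riccati.hasImproperIntegral_extremal_bot H.dual G hus.1.1 hnegu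
      (by simpa only [neg_neg] using H.tendsto_left hα)).neg
    simpa only [Pi.neg_apply, neg_mul, neg_neg, EReal.neg_bot] using hbot
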